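/- Let $\mathcal P=[p_{ij}]$ be an irreducible $n\times n$ sign pattern (entries in $\{+,-,0\}$) with zero diagonal that is combinatorially symmetric, i.e. $p_{ij}\neq 0$ if and only if $p_{ji}\neq 0$. Let $G$ be its signed undirected graph on $\{1,\dots,n\}$: $\{i,j\}$ is an edge if and only if $p_{ij}\ne 0$, and its sign is $p_{ij}p_{ji}$. Cycles are simple cycles of length at least $3$. Two distinct cycles $\mathcal C_1,\mathcal C_2$ of $G$ are called *path-adjacent* if there is a path $u\,v_1v_2\cdots v_r\,w$ in $G$ ($r\ge 0$, all vertices distinct) with $u\in V(\mathcal C_1)$, $w\in V(\mathcal C_2)$, such that none of $v_1,\dots,v_r$ is a vertex of any cycle of $G$. The distance between two cycles is $\min\{\operatorname{dist}(x,y): x\in V(\mathcal C_1),\ y\in V(\mathcal C_2)\}$. A *maximal signed path* of a cycle $\mathcal C$ is a path of length at least $1$ consisting of consecutive edges of $\mathcal C$ that all have the same sign, such that every edge of $\mathcal C$ that is not in the path but is incident with one of its two endpoints has the opposite sign. Suppose that $G$ has at least one cycle and no leaf (vertex of degree $1$), and that the distance between any two distinct path-adjacent cycles of $G$ is odd. Suppose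 moreover that at least one of the following holds: 1. $G$ has a cycle with an odd number of negative edges; 2. all cycles of $G$ have even length, and $G$ has a cycle all of whose edges are negative; 3. all cycles of $G$ have even length, and $G$ has a cycle containing a maximal signed path of odd length. Then $\mathcal P$ does not require a unique inertia. That is, the set of inertias $(i_+(A),i_-(A),i_0(A))$, where $A$ ranges over all real $n\times n$ matrices with $\operatorname{sgn}(a_{ij})=p_{ij}$ for all $i,j$, is not a singleton; here $i_+(A),i_-(A),i_0(A)$ are the numbers of eigenvalues of $A$, counted with algebraic multiplicity, with positive, negative and zero real part. -/

import Mathlib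

/-- An `n × n` sign pattern: a matrix with entries in `{+, -, 0}`. -/
abbrev SignPattern (n : ℕ) := Matrix (Fin n) (Fin n) SignType

namespace SignPattern

variable {n : ℕ}

/-- The qualitative class of `P`: all real matrices whose entries have the signs prescribed
by `P`. -/
def qualitativeClass (P : SignPattern n) : Set (Matrix (Fin n) (Fin n) ℝ) :=
  {A | ∀ i j, SignType.sign (A i j) = P i j}

/-- `P` is irreducible: no simultaneous permutation of rows and columns brings it into block
triangular form with two nonempty diagonal blocks. -/
def Irreducible (P : SignPattern n) : Prop :=
  ∀ S : Finset (Fin n), S.Nonempty → S ≠ Finset.univ → ∃ i ∈ S, ∃ j ∉ S, P i j ≠ 0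

def CombinatoriallySymmetric (P : SignPattern n) : Prop :=
  ∀ i j, P i j ≠ 0 ↔ P j i ≠ 0

def ZeroDiagonal (P : SignPattern n) : Prop :=
  ∀ i, P i i = 0

/-- The underlying undirected graph (for `P` combinatorially symmetric with a `0`-diagonal):
`i` and `j` are joined iff `p_ij` and `p_ji` are nonzero. -/
def graph (P : SignPattern n) : SimpleGraph (Fin n) where
  Adj i j := i ≠ j ∧ P i j * P j i ≠ 0
  symm := ⟨fun i j h => ⟨h.1.symm, by rw [mul_comm]; exact h.2⟩⟩
  loopless := ⟨fun _ h => h.1 rfl⟩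

instance (P : SignPattern n) : DecidableRel P.graph.Adj :=
  fun i j => inferInstanceAs (Decidable (i ≠ j ∧ P i j * P j i ≠ 0))

/-- The sign `p_ij * p_ji` of the edge `{i, j}`. -/
def edgeSign (P : SignPattern n) : Sym2 (Fin n) → SignType :=
  Sym2.lift ⟨fun i j => P i j * P j i, fun _ _ => mul_comm _ _⟩

/-- `p` is a maximal signed path in the part of the signed graph that consists of the edges in
`E`: it has at least one edge, its edges lie in `E` and all have the same sign `s`, and at each of
its two ends it stops because every further edge of `E` has a sign other than `s`. -/
def IsMaximalSignedPath (P : SignPattern n) (E : Set (Sym2 (Fin n))) {x y : Fin n}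
    (p : P.graph.Walk x y) : Prop :=
  p.IsPath ∧ 0 < p.length ∧ (∀ e ∈ p.edges, e ∈ E) ∧
    ∃ s : SignType, (∀ e ∈ p.edges, P.edgeSign e = s) ∧
      ∀ e ∈ E, e ∉ p.edges → (x ∈ e ∨ y ∈ e) → P.edgeSign e ≠ s

end SignPattern

/-- The inertia `(i₊(A), i₋(A), i₀(A))` of a real matrix: the numbers of complex eigenvalues,
counted with algebraic multiplicity, with positive, negative and zero real part. -/
noncomputable def matrixInertia {n : ℕ} (A : Matrix (Fin n) (Fin n) ℝ) : ℕ × ℕ × ℕ :=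
  open Classical in
  let ev : Multiset ℂ := (A.map (algebraMap ℝ ℂ)).charpoly.roots
  (ev.countP (fun z => 0 < z.re), ev.countP (fun z => z.re < 0), ev.countP (fun z => z.re = 0))

namespace SignPattern

/-- The inertia of a sign pattern: the set of inertias of the matrices in its qualitative class. -/
def inertiaSet {n : ℕ} (P : SignPattern n) : Set (ℕ × ℕ × ℕ) :=
  matrixInertia '' P.qualitativeClass

def RequiresUniqueInertia {n : ℕ} (P : SignPattern n) : Prop :=
  ∃ t : ℕ × ℕ × ℕ, P.inertiaSet = {t}

end SignPattern

namespace CycleGeometry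

variable {V : Type*} (G : SimpleGraph V)

/-- The vertex `v` lies on some cycle of `G`. -/
def OnCycle (v : V) : Prop :=
  ∃ (u : V) (c : G.Walk u u), c.IsCycle ∧ v ∈ c.support

variable {G}

/-- `c` and `c'` are path-adjacent: a path `u v₁ ⋯ v_r w` (`r ≥ 0`, `u ≠ w`) leads from a vertex
`u` of `c` to a vertex `w` of `c'`, and none of `v₁, …, v_r` lies on a cycle of `G`. -/
def PathAdjacent {a b : V} (c : G.Walk a a) (c' : G.Walk b b) : Prop :=
  ∃ (u w : V) (p : G.Walk u w), p.IsPath ∧ u ≠ w ∧ u ∈ c.support ∧ w ∈ c'.support ∧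
    ∀ v ∈ p.support, v ≠ u → v ≠ w → ¬ OnCycle G v

/-- The distance between two cycles: the least distance between a vertex of one and a vertex of
the other. -/
noncomputable def cycleDist {a b : V} (c : G.Walk a a) (c' : G.Walk b b) : ℕ :=
  sInf {d | ∃ x ∈ c.support, ∃ y ∈ c'.support, d = G.dist x y}

end CycleGeometry

/-! Two cycles with a common vertex would be path-adjacent at the even distance 0, so distinct
cycles are disjoint. A vertex on no cycle separates its neighbours, and since there are no leaves,
each neighbour is reached from some cycle by a path avoiding the vertex. Odd cycle distances force
these path lengths to have opposite parities at any two neighbours. Pairing the vertex with the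
neighbour of odd path length matches the vertices off the cycles perfectly
(`exists_matching_off_cycles`). Hence outside any given cycle the graph is spanned by disjoint
cycles and edges (`exists_perm_off_cycle`).

Matrices supported on such pieces lie only in the closure of the qualitative class, so what is read
off them must survive perturbation. Three things do: the sign of a nonzero determinant, which is the
parity of `i₋` (`det_pos_iff_even_inertia`); eigenvalues off the imaginary axis; and, for bipartite
graphs, simple imaginary eigenvalues, because the spectrum is then symmetric about the imaginary
axis (`InClosure.exists_roots`).

If a cycle has an odd number of negative edges, traversing it in its two directions gives
determinants of opposite sign.

If all cycles are even, the graph is bipartite. A matching with distinct weights has simple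
eigenvalues, imaginary at negative edges and real at positive ones. If the inertia is unique, `i₀`
is therefore at least the number of vertices on negative edges of any matching, and at most `n`
minus the number on positive edges; a perfect matching determines it. An all-negative cycle
contradicts this, since rotating it yields an eigenvalue off the axis. An odd maximal signed path
contradicts it too: switching a perfect matching along the path gives a matching with more edges of
that sign (`exists_involution_card_lt`). -/

open CycleGeometry SimpleGraph

/-! ### Graph structure: disjoint cycles and a matching of the remaining vertices -/

section CycleStructure

set_option linter.unusedSectionVars false

variable {V : Type*} [DecidableEq V] {G : SimpleGraph V}

lemma walk_edges_eq_map_range {u v : V} (p : G.Walk u v) :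
    p.edges = (List.range p.length).map (fun i => s(p.getVert i, p.getVert (i + 1))) := by
  induction p with
  | nil => simp
  | cons h p ih =>
    rw [Walk.edges_cons, ih, Walk.length_cons, List.range_succ_eq_map]
    simp [Function.comp_def]

/-- The cyclic shift `finRotate`, transported to the vertices of the cycle. -/
lemma exists_rotation {a : V} {c : G.Walk a a} (hc : c.IsCycle) :
    ∃ ρ : Equiv.Perm V, (∀ i < c.length, ρ (c.getVert i) = c.getVert (i + 1)) ∧
      ∀ v ∉ c.support, ρ v = v := by
  obtain ⟨k, hk⟩ : ∃ k, c.length = k + 1 :=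
    ⟨c.length - 1, by have := hc.three_le_length; omega⟩
  let f : Fin (k + 1) ↪ V :=
    ⟨fun i => c.getVert i, fun i j hij => by
      have := hc.getVert_injOn' (x₁ := (i : ℕ)) (x₂ := (j : ℕ))
        (by have := i.2; simp only [Set.mem_ofPred_eq]; omega)
        (by have := j.2; simp only [Set.mem_ofPred_eq]; omega) hij
      exact Fin.ext this⟩
  refine ⟨(finRotate (k + 1)).viaFintypeEmbedding f, fun i hi => ?_, fun v hv => ?_⟩
  · have h1 : c.getVert i = f ⟨i, by omega⟩ := rfl
    rw [h1, Equiv.Perm.viaFintypeEmbedding_apply_image]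
    rcases Nat.lt_or_ge i k with h | h
    · rw [finRotate_of_lt h]; rfl
    · have : i = k := by omega
      subst this
      rw [finRotate_last']
      change c.getVert 0 = _
      rw [Walk.getVert_zero, ← hk, Walk.getVert_length]
  · apply Equiv.Perm.viaFintypeEmbedding_apply_notMem_range
    rintro ⟨i, rfl⟩
    exact hv (Walk.getVert_mem_support _ _)

lemma isCycle_mem_support_iff {a : V} {c : G.Walk a a} (hc : c.IsCycle) {v : V} :
    v ∈ c.support ↔ ∃ i < c.length, c.getVert i = v := by
  rw [Walk.mem_support_iff_exists_getVert]
  constructor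
  · rintro ⟨i, rfl, hi⟩
    rcases hi.lt_or_eq with h | h
    · exact ⟨i, h, rfl⟩
    · refine ⟨0, by have := hc.three_le_length; omega, ?_⟩
      rw [h, Walk.getVert_zero, Walk.getVert_length]
  · rintro ⟨i, hi, rfl⟩
    exact ⟨i, rfl, hi.le⟩

lemma isCycle_mem_support_iff_edgeSet {a : V} {c : G.Walk a a} (hc : c.IsCycle) {v : V} :
    v ∈ c.support ↔ ∃ e ∈ c.edgeSet, v ∈ e := by
  constructor
  · intro hv
    obtain ⟨i, hi, rfl⟩ := (isCycle_mem_support_iff hc).1 hv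
    refine ⟨s(c.getVert i, c.getVert (i + 1)), ?_, by simp⟩
    rw [Walk.mem_edgeSet, walk_edges_eq_map_range]
    exact List.mem_map.2 ⟨i, by simpa using hi, rfl⟩
  · rintro ⟨e, he, hv⟩
    induction e with | _ x y =>
    rw [Walk.mem_edgeSet] at he
    rcases Sym2.mem_iff.1 hv with rfl | rfl
    · exact Walk.fst_mem_support_of_mem_edges _ he
    · exact Walk.snd_mem_support_of_mem_edges _ he

/-- A vertex on no cycle separates its neighbours. -/
lemma mem_support_of_adj_of_not_onCycle {z a b : V} (hz : ¬ OnCycle G z) (ha : G.Adj z a)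
    (hb : G.Adj z b) (hab : a ≠ b) (w : G.Walk a b) : z ∈ w.support := by
  by_contra hw
  have hb' : z ∉ w.bypass.support := fun h => hw (w.support_bypass_subset_support h)
  have hp : (w.bypass.concat hb.symm).IsPath := (w.bypass_isPath).concat hb' hb.symm
  refine hz ⟨z, Walk.cons ha (w.bypass.concat hb.symm), ?_, by simp⟩
  rw [Walk.cons_isCycle_iff]
  refine ⟨hp, fun h => ?_⟩
  rw [Walk.edges_concat, List.concat_eq_append, List.mem_append] at h
  rcases h with h | h
  · exact hb' (Walk.fst_mem_support_of_mem_edges _ h)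
  · rw [List.mem_singleton, Sym2.eq_iff] at h
    rcases h with ⟨h, _⟩ | ⟨_, h⟩
    · exact hb.ne h
    · exact hab h

/-- An inner vertex of a path that lies on no cycle separates the ends of the path. -/
lemma mem_support_of_isPath_of_not_onCycle {z u w : V} (hz : ¬ OnCycle G z) {p : G.Walk u w}
    (hp : p.IsPath) (hzp : z ∈ p.support) (hzu : z ≠ u) (hzw : z ≠ w) (q : G.Walk u w) :
    z ∈ q.support := by
  obtain ⟨p₁, p₂, rfl⟩ := Walk.mem_support_iff_exists_append.1 hzp
  cases p₂ with
  | nil => exact absurd rfl hzw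
  | @cons _ b _ hb r =>
  obtain ⟨p₁, rfl⟩ : ∃ p₁' : G.Walk z u, p₁ = p₁'.reverse := ⟨p₁.reverse, by simp⟩
  cases p₁ with
  | nil => exact absurd rfl hzu
  | @cons _ a _ ha l =>
  have hnd := (Walk.isPath_def _).1 hp
  have hs : ((Walk.cons ha l).reverse.append (Walk.cons hb r)).support =
      l.support.reverse ++ z :: r.support := by simp [Walk.support_append]
  rw [hs, List.nodup_append] at hnd
  obtain ⟨-, h2, h3⟩ := hnd
  have hzl : z ∉ l.support := fun h => h3 z (by simpa using h) z (by simp) rfl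
  have hzr : z ∉ r.support := (List.nodup_cons.1 h2).1
  have hab : a ≠ b := fun h =>
    h3 a (by simp) b (by simp) h
  have := mem_support_of_adj_of_not_onCycle hz ha hb hab ((l.append q).append r.reverse)
  rw [Walk.mem_support_append_iff, Walk.mem_support_append_iff, Walk.support_reverse,
    List.mem_reverse] at this
  tauto

lemma exists_walk_support_subset {a x y : V} (c : G.Walk a a) (hx : x ∈ c.support)
    (hy : y ∈ c.support) : ∃ q : G.Walk x y, q.support ⊆ c.support := by
  refine ⟨(c.takeUntil x hx).reverse.append (c.takeUntil y hy), fun v hv => ?_⟩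
  rw [Walk.mem_support_append_iff, Walk.support_reverse, List.mem_reverse] at hv
  rcases hv with hv | hv
  · exact c.support_takeUntil_subset_support hx hv
  · exact c.support_takeUntil_subset_support hy hv

lemma onCycle_of_mem {a x : V} {c : G.Walk a a} (hc : c.IsCycle) (hx : x ∈ c.support) :
    OnCycle G x := ⟨a, c, hc, hx⟩

/-- Any two distinct path-adjacent cycles are at odd distance. -/
def OddCycleDist (G : SimpleGraph V) : Prop :=
  ∀ (a b : V) (c : G.Walk a a) (c' : G.Walk b b), c.IsCycle → c'.IsCycle →
    c.edgeSet ≠ c'.edgeSet → PathAdjacent c c' → Odd (cycleDist c c')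

lemma edgeSet_eq_of_common_vertex (hG : OddCycleDist G) {a b v : V} {c : G.Walk a a}
    {c' : G.Walk b b} (hc : c.IsCycle) (hc' : c'.IsCycle) (hv : v ∈ c.support)
    (hv' : v ∈ c'.support) : c.edgeSet = c'.edgeSet := by
  by_contra hne
  -- `PathAdjacent` needs two different ends, so an edge of `c'` at the common vertex serves as the
  -- path.
  have hadj : PathAdjacent c c' := by
    obtain ⟨i, hi, rfl⟩ := (isCycle_mem_support_iff hc').1 hv'
    have hA := c'.adj_getVert_succ hi
    refine ⟨_, c'.getVert (i + 1), hA.toWalk, hA.isPath_toWalk, hA.ne, hv,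
      Walk.getVert_mem_support _ _, fun x hx h1 h2 => ?_⟩
    simp at hx
    tauto
  have h0 : cycleDist c c' = 0 :=
    Nat.sInf_eq_zero.2 (Or.inl ⟨v, hv, v, hv', by simp⟩)
  have := hG _ _ _ _ hc hc' hne hadj
  rw [h0] at this
  exact absurd this (by decide)

lemma support_iff_of_common_vertex (hG : OddCycleDist G) {a b v x : V} {c : G.Walk a a}
    {c' : G.Walk b b} (hc : c.IsCycle) (hc' : c'.IsCycle) (hv : v ∈ c.support)
    (hv' : v ∈ c'.support) : x ∈ c.support ↔ x ∈ c'.support := by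
  rw [isCycle_mem_support_iff_edgeSet hc, isCycle_mem_support_iff_edgeSet hc',
    edgeSet_eq_of_common_vertex hG hc hc' hv hv']

/-- A path between two vertices on cycles, all of whose inner vertices lie on no cycle, has odd
length as soon as there is such an inner vertex. -/
lemma odd_length_of_isPath (hG : OddCycleDist G) {u w z : V} {p : G.Walk u w} (hp : p.IsPath)
    (hu : OnCycle G u) (hw : OnCycle G w)
    (hin : ∀ v ∈ p.support, v ≠ u → v ≠ w → ¬ OnCycle G v)
    (hz : z ∈ p.support) (hzu : z ≠ u) (hzw : z ≠ w) : Odd p.length := by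
  obtain ⟨a, c, hc, hu⟩ := hu
  obtain ⟨b, c', hc', hw⟩ := hw
  -- Extending `q` along both cycles gives a walk between the ends of `p`; it must meet each inner
  -- vertex of `p`, and the cycles cannot contain it.
  have hsep : ∀ x ∈ c.support, ∀ y ∈ c'.support, ∀ q : G.Walk x y, ∀ v ∈ p.support, v ≠ u →
      v ≠ w → v ∈ q.support := by
    intro x hx y hy q v hv hvu hvw
    have hvc := hin v hv hvu hvw
    obtain ⟨q₁, h₁⟩ := exists_walk_support_subset c hu hx
    obtain ⟨q₂, h₂⟩ := exists_walk_support_subset c' hy hw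
    have := mem_support_of_isPath_of_not_onCycle hvc hp hv hvu hvw ((q₁.append q).append q₂)
    rw [Walk.mem_support_append_iff, Walk.mem_support_append_iff] at this
    rcases this with (h | h) | h
    · exact absurd (onCycle_of_mem hc (h₁ h)) hvc
    · exact h
    · exact absurd (onCycle_of_mem hc' (h₂ h)) hvc
  have hzc := hin z hz hzu hzw
  have hne : c.edgeSet ≠ c'.edgeSet := by
    intro h
    have hwc : w ∈ c.support := by
      rw [isCycle_mem_support_iff_edgeSet hc, h, ← isCycle_mem_support_iff_edgeSet hc']
      exact hw
    have := hsep w hwc w hw Walk.nil z hz hzu hzw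
    simp at this
    exact hzw this
  have huw : u ≠ w := by
    rintro rfl
    obtain rfl := (Walk.isPath_iff_nil.1 hp).eq_nil
    simp at hz
    exact hzu hz
  have hodd := hG a b c c' hc hc' hne ⟨u, w, p, hp, huw, hu, hw, hin⟩
  suffices h : cycleDist c c' = p.length by rwa [h] at hodd
  apply le_antisymm
  · have hmem : G.dist u w ∈ {d | ∃ x ∈ c.support, ∃ y ∈ c'.support, d = G.dist x y} :=
      ⟨u, hu, w, hw, rfl⟩
    exact (Nat.sInf_le hmem).trans (SimpleGraph.dist_le p)
  · obtain ⟨x, hx, y, hy, hxy⟩ := Nat.sInf_mem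
      (s := {d | ∃ x ∈ c.support, ∃ y ∈ c'.support, d = G.dist x y}) ⟨_, u, hu, w, hw, rfl⟩
    change cycleDist c c' = _ at hxy
    rw [hxy]
    obtain ⟨q₁, -⟩ := exists_walk_support_subset c hu hx
    obtain ⟨q₂, -⟩ := exists_walk_support_subset c' hy hw
    obtain ⟨q, hq, hql⟩ :=
      (Walk.reachable ((q₁.reverse.append p).append q₂.reverse)).exists_path_of_dist
    rw [← hql]
    have hxy' : x ≠ y := by
      rintro rfl
      exact hne (edgeSet_eq_of_common_vertex hG hc hc' hx hy)
    -- A shortest path between the cycles contains all inner vertices of `p` and two further ends,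
    -- so it is at least as long as `p`.
    have hsub : insert x (insert y ((p.support.toFinset.erase u).erase w)) ⊆
        q.support.toFinset := by
      intro v hv
      simp only [Finset.mem_insert, Finset.mem_erase, List.mem_toFinset] at hv ⊢
      rcases hv with rfl | rfl | ⟨h1, h2, h3⟩
      · simp
      · simp
      · exact hsep x hx y hy q v h3 h2 h1
    have hcard := Finset.card_le_card hsub
    have hoff : ∀ v ∈ (p.support.toFinset.erase u).erase w, ¬ OnCycle G v := by
      intro v hv
      simp only [Finset.mem_erase, List.mem_toFinset] at hv
      exact hin v hv.2.2 hv.2.1 hv.1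
    rw [Finset.card_insert_of_notMem, Finset.card_insert_of_notMem, Finset.card_erase_of_mem,
      Finset.card_erase_of_mem, List.toFinset_card_of_nodup hp.support_nodup,
      List.toFinset_card_of_nodup hq.support_nodup, Walk.length_support, Walk.length_support]
      at hcard
    · omega
    · simp
    · simp [huw.symm]
    · exact fun h => hoff y h (onCycle_of_mem hc' hy)
    · rw [Finset.mem_insert]
      rintro (h | h)
      · exact hxy' h
      · exact hoff x h (onCycle_of_mem hc hx)

/-- `ℓ` is the length of a path from a cycle to `a` that avoids `v` and meets the cycles of `G`
only in its first vertex. -/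
def CyclePathTo (G : SimpleGraph V) (v a : V) (l : ℕ) : Prop :=
  ∃ (u : V) (p : G.Walk u a), p.IsPath ∧ v ∉ p.support ∧ OnCycle G u ∧
    (∀ x ∈ p.support, x ≠ u → ¬ OnCycle G x) ∧ p.length = l

/-- The two paths are disjoint because `v` separates `a` from `b`. Joined through `v` they form a
path between cycles of length `k + l + 2`. -/
lemma odd_add_of_cyclePathTo (hG : OddCycleDist G) {v a b : V} {k l : ℕ} (hv : ¬ OnCycle G v)
    (ha : G.Adj v a) (hb : G.Adj v b) (hab : a ≠ b) (hk : CyclePathTo G v a k)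
    (hl : CyclePathTo G v b l) : Odd (k + l) := by
  obtain ⟨u, p, hp, hvp, hu, hpin, rfl⟩ := hk
  obtain ⟨w, q, hq, hvq, hw, hqin, rfl⟩ := hl
  have hdis : ∀ x, x ∈ p.support → x ∈ q.support → False := by
    intro x hxp hxq
    have := mem_support_of_adj_of_not_onCycle hv ha hb hab
      ((p.dropUntil x hxp).reverse.append (q.dropUntil x hxq))
    rw [Walk.mem_support_append_iff, Walk.support_reverse, List.mem_reverse] at this
    rcases this with h | h
    · exact hvp (p.support_dropUntil_subset_support hxp h)
    · exact hvq (q.support_dropUntil_subset_support hxq h)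
  have hsupp : ((p.concat ha.symm).append (Walk.cons hb q.reverse)).support =
      p.support ++ v :: q.support.reverse := by
    rw [Walk.support_append, Walk.support_concat, Walk.support_cons, Walk.support_reverse]
    simp
  have hpath : ((p.concat ha.symm).append (Walk.cons hb q.reverse)).IsPath := by
    rw [Walk.isPath_def, hsupp, List.nodup_append]
    refine ⟨hp.support_nodup, ?_, ?_⟩
    · rw [List.nodup_cons, List.nodup_reverse, List.mem_reverse]
      exact ⟨hvq, hq.support_nodup⟩
    · rintro x hx y hy rfl
      rw [List.mem_cons, List.mem_reverse] at hy
      rcases hy with rfl | hy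
      · exact hvp hx
      · exact hdis _ hx hy
  have hodd := odd_length_of_isPath hG hpath hu hw (z := v) (by
      intro x hx hxu hxw
      rw [hsupp, List.mem_append, List.mem_cons, List.mem_reverse] at hx
      rcases hx with hx | rfl | hx
      · exact hpin x hx hxu
      · exact hv
      · exact hqin x hx hxw) (by rw [hsupp]; simp)
      (by rintro rfl; exact hv hu) (by rintro rfl; exact hv hw)
  rw [Walk.length_append, Walk.length_concat, Walk.length_cons, Walk.length_reverse] at hodd
  rw [Nat.odd_iff] at hodd ⊢
  omega

/-- Walk away from `v`, starting at `a`. Without leaves the walk can always go on, it cannot return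
to itself before it meets a cycle, and the graph is finite. -/
lemma exists_cyclePathTo [Fintype V] (hdeg : ∀ x a, G.Adj x a → ∃ b, b ≠ a ∧ G.Adj x b)
    {v a : V} (ha : G.Adj v a) : ∃ l, CyclePathTo G v a l := by
  by_contra hno
  have key : ∀ N : ℕ, ∃ (x : V) (p : G.Walk x a), p.IsPath ∧ v ∉ p.support ∧
      (∀ y ∈ p.support, ¬ OnCycle G y) ∧ N ≤ p.length := by
    intro N
    induction N with
    | zero =>
      refine ⟨a, Walk.nil, Walk.IsPath.nil, by simpa using ha.ne, ?_, le_rfl⟩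
      intro y hy hy'
      obtain rfl : y = a := by simpa using hy
      exact hno ⟨0, y, Walk.nil, Walk.IsPath.nil, by simpa using ha.ne, hy', by simp, rfl⟩
    | succ N ih =>
      obtain ⟨x, p, hp, hvp, hoff, hN⟩ := ih
      -- A second neighbour of `x` on the path would put `x` on a cycle.
      have hpx : ∃ b, (∀ y, G.Adj x y → y ∈ (p.concat ha.symm).support → y = b) ∧
          G.Adj x b := by
        have hp' := hp.concat hvp ha.symm
        have hxb : ∀ b (h : G.Adj x b) (q : G.Walk b v), p.concat ha.symm = Walk.cons h q →
            ∀ y, G.Adj x y → y ∈ (p.concat ha.symm).support → y = b := by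
          intro b h q hpq y hy hyp
          by_contra hyb
          rw [hpq] at hyp hp'
          rw [Walk.cons_isPath_iff] at hp'
          rw [Walk.support_cons, List.mem_cons] at hyp
          rcases hyp with rfl | hyq
          · exact hy.ne rfl
          · have := mem_support_of_adj_of_not_onCycle (hoff x (by simp)) h hy (Ne.symm hyb)
              (q.takeUntil y hyq)
            exact hp'.2 (q.support_takeUntil_subset_support hyq this)
        generalize hP : p.concat ha.symm = P at *
        cases P with
        | nil => simp at hvp
        | @cons _ b _ h q => exact ⟨b, hxb b h q rfl, h⟩
      obtain ⟨b, hb, hxb⟩ := hpx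
      obtain ⟨y, hyb, hxy⟩ := hdeg x b hxb
      have hy : y ∉ (p.concat ha.symm).support := fun h => hyb (hb y hxy h)
      rw [Walk.support_concat, List.mem_append, List.mem_singleton, not_or]
        at hy
      have hpath : (Walk.cons hxy.symm p).IsPath := hp.cons hy.1
      have hvn : v ∉ (Walk.cons hxy.symm p).support := by
        rw [Walk.support_cons, List.mem_cons, not_or]
        exact ⟨Ne.symm hy.2, hvp⟩
      refine ⟨y, Walk.cons hxy.symm p, hpath, hvn, ?_, by rw [Walk.length_cons]; omega⟩
      intro z hz
      rw [Walk.support_cons, List.mem_cons] at hz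
      rcases hz with rfl | hz
      · intro hyc
        refine hno ⟨_, z, Walk.cons hxy.symm p, hpath, hvn, hyc, ?_, rfl⟩
        intro w hw hwz
        rw [Walk.support_cons, List.mem_cons] at hw
        exact hoff w (hw.resolve_left hwz)
      · exact hoff z hz
  obtain ⟨x, p, hp, -, -, hN⟩ := key (Fintype.card V)
  exact absurd hp.length_lt (by omega)

/-- The vertices on no cycle can be matched perfectly among themselves. -/
lemma exists_matching_off_cycles [Fintype V] (hG : OddCycleDist G) (hdeg0 : ∀ v, ∃ a, G.Adj v a)
    (hdeg : ∀ x a, G.Adj x a → ∃ b, b ≠ a ∧ G.Adj x b) :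
    ∃ m : V → V, (∀ v, m (m v) = v) ∧ (∀ v, OnCycle G v → m v = v) ∧
      ∀ v, ¬ OnCycle G v → G.Adj v (m v) := by
  classical
  -- By opposite parities at most one neighbour has an odd path. The partner is itself off the
  -- cycles, since an odd path has positive length and meets cycles only at its start.
  let R : V → V → Prop := fun v a =>
    ¬ OnCycle G v ∧ G.Adj v a ∧ ∃ l, Odd l ∧ CyclePathTo G v a l
  have hex : ∀ v, ¬ OnCycle G v → ∃ a, R v a := by
    intro v hv
    obtain ⟨a, ha⟩ := hdeg0 v
    obtain ⟨b, hba, hb⟩ := hdeg v a ha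
    obtain ⟨k, hk⟩ := exists_cyclePathTo hdeg ha
    obtain ⟨l, hl⟩ := exists_cyclePathTo hdeg hb
    have := odd_add_of_cyclePathTo hG hv ha hb hba.symm hk hl
    rcases Nat.even_or_odd k with h | h
    · exact ⟨b, hv, hb, l, by rw [Nat.odd_add'] at this; exact this.2 h, hl⟩
    · exact ⟨a, hv, ha, k, h, hk⟩
  have huniq : ∀ v a b, R v a → R v b → a = b := by
    rintro v a b ⟨hv, ha, k, hk, hka⟩ ⟨-, hb, l, hl, hlb⟩
    by_contra hab
    have := odd_add_of_cyclePathTo hG hv ha hb hab hka hlb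
    exact (Nat.not_odd_iff_even.2 (hk.add_odd hl)) this
  have hsymm : ∀ v a, R v a → R a v := by
    rintro v a ⟨hv, ha, k, hk, u, p, hp, hvp, hu, hin, rfl⟩
    obtain ⟨p, rfl⟩ : ∃ p' : G.Walk a u, p = p'.reverse := ⟨p.reverse, by simp⟩
    cases p with
    | nil => simp at hk
    | @cons _ b _ hab q =>
    rw [Walk.isPath_reverse_iff, Walk.cons_isPath_iff] at hp
    simp only [Walk.support_reverse, Walk.support_cons, List.mem_reverse, List.mem_cons,
      not_or] at hvp hin
    have hau : a ≠ u := by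
      rintro rfl
      exact hp.2 (by simp)
    have hac := hin a (Or.inl rfl) hau
    have hb : CyclePathTo G a b q.length :=
      ⟨u, q.reverse, hp.1.reverse, by simpa using hp.2, hu,
        fun x hx hxu => hin x (Or.inr (by simpa using hx)) hxu, by simp⟩
    obtain ⟨l, hl⟩ := exists_cyclePathTo hdeg ha.symm
    have hbv : b ≠ v := by
      rintro rfl
      exact hvp.2 (by simp)
    have := odd_add_of_cyclePathTo hG hac hab ha.symm hbv hb hl
    refine ⟨hac, ha.symm, l, ?_, hl⟩
    rw [Walk.length_reverse, Walk.length_cons] at hk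
    rw [Nat.odd_iff] at *
    omega
  choose! g hg using hex
  refine ⟨fun v => if OnCycle G v then v else g v, fun v => ?_, fun v hv => by simp [hv],
    fun v hv => by simpa [hv] using (hg v hv).2.1⟩
  by_cases hv : OnCycle G v
  · simp [hv]
  · have h1 := hsymm _ _ (hg v hv)
    have h2 := hg _ h1.1
    simp only [hv, h1.1, if_false]
    exact huniq _ _ _ h2 h1

/-- Outside a given cycle, `G` is spanned by disjoint cycles and edges. -/
lemma exists_perm_off_cycle [Fintype V] (hG : OddCycleDist G) (hdeg0 : ∀ v, ∃ a, G.Adj v a)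
    (hdeg : ∀ x a, G.Adj x a → ∃ b, b ≠ a ∧ G.Adj x b) {a : V} {c : G.Walk a a}
    (hc : c.IsCycle) :
    ∃ h : Equiv.Perm V, (∀ v ∈ c.support, h v = v) ∧ ∀ v ∉ c.support, G.Adj v (h v) := by
  classical
  -- `M` is a union of vertex sets of cycles that includes `c`; `g` rotates all of them except `c`.
  -- The cycles are added one at a time.
  have key : ∀ S : Finset V, ∃ (M : Finset V) (g : Equiv.Perm V),
      (∀ v ∈ S, OnCycle G v → v ∈ M) ∧ (∀ v ∈ M, OnCycle G v) ∧ (∀ v ∈ c.support, v ∈ M) ∧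
      (∀ (b : V) (d : G.Walk b b), d.IsCycle → ∀ v ∈ d.support, v ∈ M → ∀ w ∈ d.support, w ∈ M) ∧
      (∀ v ∈ c.support, g v = v) ∧ (∀ v ∉ M, g v = v) ∧
      ∀ v ∈ M, v ∉ c.support → G.Adj v (g v) := by
    intro S
    induction S using Finset.induction_on with
    | empty =>
      refine ⟨c.support.toFinset, 1, by simp, fun v hv => onCycle_of_mem hc (by simpa using hv),
        by simp, ?_, by simp, by simp, fun v hv hv' => absurd (by simpa using hv) hv'⟩
      intro b d hd v hv hvc w hw
      rw [List.mem_toFinset] at hvc ⊢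
      exact (support_iff_of_common_vertex hG hd hc hv hvc).1 hw
    | insert x S hx ih =>
      obtain ⟨M, g, h1, h2, h3, h4, h5, h6, h7⟩ := ih
      by_cases hxM : ¬ OnCycle G x ∨ x ∈ M
      · refine ⟨M, g, ?_, h2, h3, h4, h5, h6, h7⟩
        intro v hv hvc
        rcases Finset.mem_insert.1 hv with rfl | hv
        · tauto
        · exact h1 v hv hvc
      · push Not at hxM
        obtain ⟨⟨b, d, hd, hxd⟩, hxM⟩ := hxM
        obtain ⟨ρ, hρ, hρ'⟩ := exists_rotation hd
        have hdM : ∀ v ∈ d.support, v ∉ M := fun v hv hvM => hxM (h4 b d hd v hv hvM x hxd)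
        have hρd : ∀ v ∈ d.support, G.Adj v (ρ v) := by
          intro v hv
          obtain ⟨i, hi, rfl⟩ := (isCycle_mem_support_iff hd).1 hv
          rw [hρ i hi]
          exact d.adj_getVert_succ hi
        refine ⟨M ∪ d.support.toFinset, ρ * g, ?_, ?_, ?_, ?_, ?_, ?_, ?_⟩
        · intro v hv hvc
          rw [Finset.mem_union, List.mem_toFinset]
          rcases Finset.mem_insert.1 hv with rfl | hv
          · exact Or.inr hxd
          · exact Or.inl (h1 v hv hvc)
        · intro v hv
          rw [Finset.mem_union, List.mem_toFinset] at hv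
          exact hv.elim (h2 v) (onCycle_of_mem hd)
        · exact fun v hv => Finset.mem_union_left _ (h3 v hv)
        · intro b' d' hd' v hv hvM w hw
          rw [Finset.mem_union, List.mem_toFinset] at hvM ⊢
          rcases hvM with hvM | hvd
          · exact Or.inl (h4 b' d' hd' v hv hvM w hw)
          · exact Or.inr ((support_iff_of_common_vertex hG hd' hd hv hvd).1 hw)
        · intro v hv
          rw [Equiv.Perm.mul_apply, h5 v hv]
          exact hρ' v fun h => hdM v h (h3 v hv)
        · intro v hv
          rw [Finset.mem_union, List.mem_toFinset, not_or] at hv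
          rw [Equiv.Perm.mul_apply, h6 v hv.1, hρ' v hv.2]
        · intro v hv hvc
          rw [Equiv.Perm.mul_apply]
          rw [Finset.mem_union, List.mem_toFinset] at hv
          rcases hv with hv | hv
          · have hgv : g v ∈ M := by
              by_contra hgM
              have := g.injective (h6 _ hgM)
              exact hgM (this.symm ▸ hv)
            rw [hρ' _ fun h => hdM _ h hgv]
            exact h7 v hv hvc
          · rw [h6 v (hdM v hv)]
            exact hρd v hv
  obtain ⟨M, g, h1, h2, -, -, h5, h6, h7⟩ := key Finset.univ
  obtain ⟨m, hm1, hm2, hm3⟩ := exists_matching_off_cycles hG hdeg0 hdeg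
  let μ : Equiv.Perm V := ⟨m, m, hm1, hm1⟩
  have hM : ∀ v, v ∈ M ↔ OnCycle G v := fun v => ⟨h2 v, h1 v (Finset.mem_univ _)⟩
  refine ⟨g * μ, fun v hv => ?_, fun v hv => ?_⟩
  · have : μ v = v := hm2 v (onCycle_of_mem hc hv)
    rw [Equiv.Perm.mul_apply, this, h5 v hv]
  · rw [Equiv.Perm.mul_apply]
    by_cases hvc : OnCycle G v
    · have : μ v = v := hm2 v hvc
      rw [this]
      exact h7 v ((hM v).2 hvc) hv
    · have hmv : ¬ OnCycle G (m v) := fun h => by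
        have := hm2 _ h
        rw [hm1] at this
        exact hvc (this ▸ h)
      have : μ v = m v := rfl
      rw [this, h6 _ (fun h => hmv ((hM _).1 h))]
      exact hm3 v hvc

end CycleStructure

/-! ### Graphs with only even cycles are bipartite -/

section Bipartite

variable {V : Type*} {G : SimpleGraph V}

/-- Each detour that `bypass` cuts out is either an edge traversed back and forth or a cycle, hence
of even length. -/
lemma even_length_iff_even_length_bypass [DecidableEq V]
    (hG : ∀ (a : V) (c : G.Walk a a), c.IsCycle → Even c.length) {u v : V} (p : G.Walk u v) :
    Even p.length ↔ Even p.bypass.length := by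
  induction p with
  | nil => simp [Walk.bypass]
  | @cons u v w h p ih =>
    rw [Walk.bypass]
    split_ifs with hu
    · have hlen := congrArg Walk.length (p.bypass.take_spec hu)
      rw [Walk.length_append] at hlen
      have hq := (p.bypass_isPath).takeUntil hu
      have hodd : Odd (p.bypass.takeUntil u hu).length := by
        by_cases he : s(u, v) ∈ (p.bypass.takeUntil u hu).edges
        · rw [hq.length_eq_one_of_mem_edges (by rwa [Sym2.eq_swap])]
          exact odd_one
        · have := hG u _ ((Walk.cons_isCycle_iff _ h).2 ⟨hq, he⟩)
          rw [Walk.length_cons] at this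
          rw [Nat.even_iff] at this
          rw [Nat.odd_iff]
          omega
      rw [Walk.length_cons]
      rw [← hlen] at ih
      rw [Nat.even_iff, Nat.even_iff] at *
      rw [Nat.odd_iff] at hodd
      omega
    · rw [Walk.length_cons, Walk.length_cons, Nat.even_add_one, Nat.even_add_one, ih]

lemma exists_bool_coloring (hG : ∀ (a : V) (c : G.Walk a a), c.IsCycle → Even c.length) :
    ∃ col : V → Bool, ∀ x y, G.Adj x y → col x ≠ col y := by
  classical
  have h2 : G.Colorable 2 := by
    rw [two_colorable_iff_forall_loop_even]
    intro u w
    rw [even_length_iff_even_length_bypass hG, (Walk.isPath_iff_nil.1 w.bypass_isPath).eq_nil]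
    simp
  obtain ⟨C⟩ := h2
  refine ⟨fun v => finTwoEquiv (C v), fun x y h he => ?_⟩
  exact C.valid h (finTwoEquiv.injective he)

end Bipartite

/-! ### Continuity and symmetry of the spectrum -/

section Roots

open Filter Topology Matrix

lemma exists_map_univ_eq {α : Type*} {n : ℕ} (s : Multiset α) (hs : s.card = n) :
    ∃ z : Fin n → α, s = Finset.univ.val.map z := by
  subst hs
  refine ⟨fun i => s.toList.get (i.cast (by simp)), ?_⟩
  conv_lhs => rw [← s.coe_toList]
  have h := List.ofFn_get s.toList
  rw [Fin.univ_val_map]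
  conv_lhs => rw [← h]
  congr 1
  apply List.ext_get
  · simp
  · intro i h1 h2
    simp

lemma exists_charpoly_roots_eq {n : ℕ} (M : Matrix (Fin n) (Fin n) ℂ) :
    ∃ z : Fin n → ℂ, M.charpoly.roots = Finset.univ.val.map z := by
  apply exists_map_univ_eq
  have := IsAlgClosed.card_roots_eq_natDegree (p := M.charpoly)
  rw [this, Matrix.charpoly_natDegree_eq_dim, Fintype.card_fin]

lemma charpoly_eq_prod {n : ℕ} {M : Matrix (Fin n) (Fin n) ℂ} {z : Fin n → ℂ}
    (h : M.charpoly.roots = Finset.univ.val.map z) :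
    M.charpoly = ∏ j, (Polynomial.X - Polynomial.C (z j)) := by
  have := (IsAlgClosed.splits M.charpoly).eq_prod_roots_of_monic M.charpoly_monic
  rw [this, h, Multiset.map_map]
  rfl

/-- A crude form of Gershgorin's theorem; what matters is that the bound is continuous in `M`, which
confines the eigenvalues of a convergent sequence to a compact set. -/
lemma norm_le_sum_of_mem_roots {n : ℕ} {M : Matrix (Fin n) (Fin n) ℂ} {z : ℂ}
    (h : z ∈ M.charpoly.roots) : ‖z‖ ≤ ∑ i, ∑ j, ‖M i j‖ := by
  have hr := (Polynomial.mem_roots'.1 h).2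
  rw [← Matrix.charpoly_toLin', ← Module.End.hasEigenvalue_iff_isRoot_charpoly] at hr
  obtain ⟨k, hk⟩ := eigenvalue_mem_ball hr
  rw [mem_closedBall_iff_norm] at hk
  calc ‖z‖ = ‖M k k + (z - M k k)‖ := by congr 1; ring
    _ ≤ ‖M k k‖ + ∑ j ∈ Finset.univ.erase k, ‖M k j‖ := (norm_add_le _ _).trans (by gcongr)
    _ = ∑ j, ‖M k j‖ := Finset.add_sum_erase _ (fun j => ‖M k j‖) (Finset.mem_univ k)
    _ ≤ _ := Finset.single_le_sum (f := fun i => ∑ j, ‖M i j‖)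
      (fun i _ => Finset.sum_nonneg fun j _ => norm_nonneg _) (Finset.mem_univ k)

/-- Along a subsequence, the eigenvalues of a convergent sequence of matrices converge to those
of the limit. -/
lemma exists_subseq_tendsto_roots {n : ℕ} {A : ℕ → Matrix (Fin n) (Fin n) ℂ}
    {B : Matrix (Fin n) (Fin n) ℂ} (h : Tendsto A atTop (𝓝 B)) :
    ∃ (φ : ℕ → ℕ) (z : ℕ → Fin n → ℂ) (w : Fin n → ℂ),
      (∀ k, (A (φ k)).charpoly.roots = Finset.univ.val.map (z k)) ∧
      B.charpoly.roots = Finset.univ.val.map w ∧ Tendsto z atTop (𝓝 w) := by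
  choose z hz using fun k => exists_charpoly_roots_eq (A k)
  have hsum : Tendsto (fun k => ∑ i, ∑ j, ‖A k i j‖) atTop (𝓝 (∑ i, ∑ j, ‖B i j‖)) := by
    refine tendsto_finsetSum _ fun i _ => tendsto_finsetSum _ fun j _ => ?_
    exact (((continuous_apply j).comp (continuous_apply i)).tendsto B |>.comp h).norm
  obtain ⟨R, hR⟩ := hsum.bddAbove_range
  have hbd : ∀ k, z k ∈ Set.pi Set.univ fun _ : Fin n => Metric.closedBall (0 : ℂ) R := by
    intro k j _
    rw [mem_closedBall_zero_iff]
    refine (norm_le_sum_of_mem_roots (M := A k) ?_).trans (hR ⟨k, rfl⟩)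
    rw [hz k]
    exact Multiset.mem_map.2 ⟨j, Finset.mem_univ_val j, rfl⟩
  obtain ⟨w, -, φ, hφ, hw⟩ :=
    (isCompact_univ_pi fun _ => isCompact_closedBall (0 : ℂ) R).tendsto_subseq hbd
  refine ⟨φ, z ∘ φ, w, fun k => hz _, ?_, hw⟩
  have hpoly : B.charpoly = ∏ j, (Polynomial.X - Polynomial.C (w j)) := by
    apply Polynomial.funext
    intro x
    have h1 : Tendsto (fun k => (A (φ k)).charpoly.eval x) atTop (𝓝 (B.charpoly.eval x)) := by
      simp only [Matrix.eval_charpoly]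
      have hc : Continuous fun M : Matrix (Fin n) (Fin n) ℂ => (Matrix.scalar (Fin n) x - M).det :=
        (continuous_const.sub continuous_id).matrix_det
      exact (hc.tendsto B).comp (h.comp hφ.tendsto_atTop)
    have h2 : Tendsto (fun k => (A (φ k)).charpoly.eval x) atTop
        (𝓝 ((∏ j, (Polynomial.X - Polynomial.C (w j))).eval x)) := by
      simp only [fun k => charpoly_eq_prod (hz (φ k)), Polynomial.eval_prod, Polynomial.eval_sub,
        Polynomial.eval_X, Polynomial.eval_C]
      refine tendsto_finsetProd _ fun j _ => tendsto_const_nhds.sub ?_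
      exact ((continuous_apply j).tendsto w).comp hw
    exact tendsto_nhds_unique h1 h2
  rw [hpoly]
  have := Polynomial.roots_multiset_prod_X_sub_C (Finset.univ.val.map w)
  rw [Multiset.map_map] at this
  exact this

/-- Conjugation by the diagonal matrix of colours `±1` turns `A` into `-A`, and `A` is real; so its
spectrum is invariant under reflection in the imaginary axis. -/
lemma neg_conj_mem_roots {n : ℕ} {A : Matrix (Fin n) (Fin n) ℝ} {col : Fin n → Bool}
    (hcol : ∀ i j, A i j ≠ 0 → col i ≠ col j) {z : ℂ}
    (hz : z ∈ (A.map (algebraMap ℝ ℂ)).charpoly.roots) :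
    -(starRingEnd ℂ z) ∈ (A.map (algebraMap ℝ ℂ)).charpoly.roots := by
  rw [Polynomial.mem_roots (Matrix.charpoly_monic _).ne_zero, Polynomial.IsRoot,
    Matrix.eval_charpoly] at hz ⊢
  let d : Fin n → ℂ := fun i => if col i then 1 else -1
  have : Matrix.scalar (Fin n) (-(starRingEnd ℂ z)) - A.map (algebraMap ℝ ℂ) =
      Matrix.diagonal (-d) * ((starRingEnd ℂ).mapMatrix
        (Matrix.scalar (Fin n) z - A.map (algebraMap ℝ ℂ))) * Matrix.diagonal d := by
    ext i j
    rw [Matrix.mul_diagonal, Matrix.diagonal_mul]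
    by_cases hij : i = j
    · subst hij
      have : A i i = 0 := by
        by_contra h
        exact hcol i i h rfl
      by_cases hi : col i <;> simp [d, this, hi]
    · by_cases hA : A i j = 0
      · simp [hij, hA]
      · have := hcol i j hA
        by_cases hi : col i <;> by_cases hj : col j <;> simp_all [d]
  rw [this, Matrix.det_mul, Matrix.det_mul, ← RingHom.map_det, hz]
  simp

end Roots

/-! ### The determinant and the parity of `i₋` -/

section Parity

lemma exists_prod_eq_of_real (R : Multiset ℂ) [DecidablePred fun z : ℂ => z.re < 0]
    (h : ∀ z ∈ R, z.im = 0 ∧ z ≠ 0) :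
    ∃ r : ℝ, R.prod = r ∧ r ≠ 0 ∧ (0 < r ↔ Even (R.countP fun z => z.re < 0)) := by
  induction R using Multiset.induction_on with
  | empty => exact ⟨1, by simp⟩
  | cons z R ih =>
    obtain ⟨r, hr, hr0, hev⟩ := ih fun w hw => h w (Multiset.mem_cons_of_mem hw)
    obtain ⟨him, hz0⟩ := h z (Multiset.mem_cons_self z R)
    have hz : z = (z.re : ℂ) := Complex.ext rfl (by simp [him])
    have hre : z.re ≠ 0 := fun h0 => hz0 (by rw [hz, h0]; simp)
    refine ⟨z.re * r, by rw [Multiset.prod_cons, hr, Complex.ofReal_mul, ← hz],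
      mul_ne_zero hre hr0, ?_⟩
    rw [Multiset.countP_cons]
    rcases lt_or_gt_of_ne hre with h1 | h1
    · rw [if_pos h1, Nat.even_add_one, ← hev]
      rw [mul_pos_iff]
      constructor
      · rintro (h | h)
        · exact absurd h.1 h1.not_gt
        · exact h.2.not_gt
      · intro h
        exact Or.inr ⟨h1, lt_of_le_of_ne (not_lt.1 h) hr0⟩
    · rw [if_neg h1.not_gt, add_zero, ← hev, mul_pos_iff_of_pos_left h1]

/-- The sign of the determinant is the parity of the number of eigenvalues with negative real
part. -/
lemma det_pos_iff_even_inertia {n : ℕ} {A : Matrix (Fin n) (Fin n) ℝ} (hA : A.det ≠ 0) :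
    0 < A.det ↔ Even (matrixInertia A).2.1 := by
  classical
  set S := (A.map (algebraMap ℝ ℂ)).charpoly.roots with hS
  have hconj : S.map (starRingEnd ℂ) = S := by
    rw [hS, ← (IsAlgClosed.splits (A.map (algebraMap ℝ ℂ)).charpoly).roots_map (starRingEnd ℂ),
      ← Matrix.charpoly_map]
    congr 2
    ext i j
    simp
  have hdet : ((A.det : ℝ) : ℂ) = S.prod := by
    rw [hS, ← Matrix.det_eq_prod_roots_charpoly]
    exact RingHom.map_det (algebraMap ℝ ℂ) A
  have h0 : (0 : ℂ) ∉ S := fun h => hA (by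
    have := Multiset.prod_eq_zero h
    rw [← hdet] at this
    exact_mod_cast this)
  set T := S.filter fun z => 0 < z.im with hT
  have hneg : S.filter (fun z => z.im < 0) = T.map (starRingEnd ℂ) := by
    conv_lhs => rw [← hconj]
    rw [Multiset.filter_map]
    congr 1
    apply Multiset.filter_congr
    intro z _
    simp
  set R := S.filter fun z => z.im = 0 with hR
  -- Nonreal eigenvalues come in conjugate pairs, which multiply the determinant by a positive
  -- number and change the count by an even one. Only the real ones matter.
  have hsplit : S = R + (T + T.map (starRingEnd ℂ)) := by
    rw [← hneg]
    conv_lhs => rw [← Multiset.filter_add_not (fun z : ℂ => z.im = 0) S]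
    congr 1
    rw [← Multiset.filter_add_not (fun z : ℂ => 0 < z.im) (S.filter fun z => ¬ z.im = 0),
      Multiset.filter_filter, Multiset.filter_filter]
    congr 1
    · apply Multiset.filter_congr
      intro z _
      exact ⟨fun h => h.1, fun h => ⟨h, h.ne'⟩⟩
    · apply Multiset.filter_congr
      intro z _
      constructor
      · exact fun h => lt_of_le_of_ne (not_lt.1 h.1) h.2
      · exact fun h => ⟨h.not_gt, h.ne⟩
  have hin : (matrixInertia A).2.1 = S.countP fun z => z.re < 0 := by
    simp only [matrixInertia]
    convert rfl
  obtain ⟨r, hr, hr0, hev⟩ := exists_prod_eq_of_real R (by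
    intro z hz
    rw [hR, Multiset.mem_filter] at hz
    exact ⟨hz.2, fun h => h0 (h ▸ hz.1)⟩)
  have hTprod : T.prod * (T.map (starRingEnd ℂ)).prod = (Complex.normSq T.prod : ℂ) := by
    rw [← map_multiset_prod, Complex.mul_conj]
  have hTpos : 0 < Complex.normSq T.prod := by
    rw [Complex.normSq_pos]
    intro h
    rw [Multiset.prod_eq_zero_iff] at h
    exact h0 (Multiset.mem_of_mem_filter h)
  have hd : A.det = r * Complex.normSq T.prod := by
    have : ((A.det : ℝ) : ℂ) = r * (Complex.normSq T.prod : ℂ) := by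
      rw [hdet, hsplit, Multiset.prod_add, Multiset.prod_add, hr, hTprod]
    exact_mod_cast this
  rw [hd, mul_pos_iff_of_pos_right hTpos, hev, hin]
  conv_rhs => rw [hsplit]
  rw [Multiset.countP_add, Multiset.countP_add, Multiset.countP_map, ← Multiset.countP_eq_card_filter]
  simp only [Complex.conj_re]
  rw [← two_mul, Nat.even_add]
  simp

end Parity

/-! ### What a unique inertia imposes on limit matrices -/

section Limits

open Filter Topology Matrix

variable {n : ℕ}

namespace SignPattern

/-- `A` lies in the closure of the qualitative class of `P`. -/
def InClosure (P : SignPattern n) (A : Matrix (Fin n) (Fin n) ℝ) : Prop :=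
  ∀ i j, A i j = 0 ∨ SignType.sign (A i j) = P i j

lemma sign_mul_coe {r : ℝ} (hr : 0 < r) (s : SignType) : SignType.sign (r * (s : ℝ)) = s := by
  rw [sign_mul, sign_pos hr, one_mul]
  cases s <;> simp

lemma InClosure.exists_seq {P : SignPattern n} {A : Matrix (Fin n) (Fin n) ℝ}
    (hA : P.InClosure A) : ∃ B : ℕ → Matrix (Fin n) (Fin n) ℝ,
      (∀ k, B k ∈ P.qualitativeClass) ∧ Tendsto B atTop (𝓝 A) := by
  -- Adding a positive multiple of `P` fills the missing entries and moves the others away from 0.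
  refine ⟨fun k => Matrix.of fun i j => A i j + (1 / ((k : ℝ) + 1)) * (P i j : ℝ), ?_, ?_⟩
  · intro k i j
    have hk : (0 : ℝ) < 1 / ((k : ℝ) + 1) := by positivity
    change SignType.sign (A i j + (1 / ((k : ℝ) + 1)) * (P i j : ℝ)) = P i j
    rcases hA i j with h | h
    · rw [h, zero_add, sign_mul_coe hk]
    · rw [← h]
      rcases lt_trichotomy (A i j) 0 with h0 | h0 | h0
      · rw [sign_neg h0, sign_neg]
        simp only [SignType.coe_neg_one]
        linarith
      · simp [h0]
      · rw [sign_pos h0, sign_pos]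
        simp only [SignType.coe_one]
        linarith
  · refine tendsto_pi_nhds.2 fun i => tendsto_pi_nhds.2 fun j => ?_
    have := (tendsto_one_div_add_atTop_nhds_zero_nat (𝕜 := ℝ)).mul_const (P i j : ℝ)
    have := this.const_add (A i j)
    simpa using this

lemma RequiresUniqueInertia.not_det_neg_pos {P : SignPattern n} (hP : P.RequiresUniqueInertia)
    {A B : Matrix (Fin n) (Fin n) ℝ} (hA : P.InClosure A) (hB : P.InClosure B)
    (hAd : A.det < 0) (hBd : 0 < B.det) : False := by
  obtain ⟨t, ht⟩ := hP
  have hdet : Continuous fun M : Matrix (Fin n) (Fin n) ℝ => M.det := continuous_id.matrix_det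
  obtain ⟨A', hA', hAlim⟩ := hA.exists_seq
  obtain ⟨B', hB', hBlim⟩ := hB.exists_seq
  obtain ⟨k, hk⟩ := (((hdet.tendsto A).comp hAlim).eventually_lt_const hAd).exists
  obtain ⟨l, hl⟩ := (((hdet.tendsto B).comp hBlim).eventually_const_lt hBd).exists
  simp only [Function.comp_apply] at hk hl
  have h1 : matrixInertia (A' k) = t := by
    have : matrixInertia (A' k) ∈ P.inertiaSet := ⟨_, hA' k, rfl⟩
    rwa [ht] at this
  have h2 : matrixInertia (B' l) = t := by
    have : matrixInertia (B' l) ∈ P.inertiaSet := ⟨_, hB' l, rfl⟩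
    rwa [ht] at this
  have h3 := (det_pos_iff_even_inertia hl.ne').1 hl
  rw [h2, ← h1] at h3
  exact hk.not_gt ((det_pos_iff_even_inertia hk.ne).2 h3)

/-- The number of imaginary eigenvalues that `P` requires lies between the numbers of simple and
of all imaginary eigenvalues of any matrix in the closure of the qualitative class. -/
lemma InClosure.exists_roots {P : SignPattern n} {t : ℕ × ℕ × ℕ} (ht : P.inertiaSet = {t})
    {A : Matrix (Fin n) (Fin n) ℝ} (hA : P.InClosure A) :
    ∃ w : Fin n → ℂ, (A.map (algebraMap ℝ ℂ)).charpoly.roots = Finset.univ.val.map w ∧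
      t.2.2 ≤ (Finset.univ.filter fun j => (w j).re = 0).card ∧
      ∀ col : Fin n → Bool, (∀ i j, P i j ≠ 0 → col i ≠ col j) →
        (Finset.univ.filter fun j => (w j).re = 0 ∧ ∀ j', j' ≠ j → w j' ≠ w j).card ≤ t.2.2 := by
  classical
  obtain ⟨B, hB, hlim⟩ := hA.exists_seq
  have hlim' : Tendsto (fun k => (B k).map (algebraMap ℝ ℂ)) atTop
      (𝓝 (A.map (algebraMap ℝ ℂ))) := by
    have hc : Continuous fun M : Matrix (Fin n) (Fin n) ℝ => M.map (algebraMap ℝ ℂ) :=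
      continuous_id.matrix_map Complex.continuous_ofReal
    exact (hc.tendsto A).comp hlim
  obtain ⟨φ, z, w, hz, hw, hzw⟩ := exists_subseq_tendsto_roots hlim'
  have hzj : ∀ j, Tendsto (fun k => z k j) atTop (𝓝 (w j)) := fun j =>
    ((continuous_apply j).tendsto w).comp hzw
  have hcount : ∀ k, t.2.2 = (Finset.univ.filter fun j => (z k j).re = 0).card := by
    intro k
    have h1 : matrixInertia (B (φ k)) = t := by
      have : matrixInertia (B (φ k)) ∈ P.inertiaSet := ⟨_, hB _, rfl⟩
      rwa [ht] at this
    rw [← h1]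
    simp only [matrixInertia]
    rw [hz k, Multiset.countP_map]
    simp only [Finset.card_def, Finset.filter_val]
  refine ⟨w, hw, ?_, fun col hcol => ?_⟩
  · have hev : ∀ᶠ k in atTop, ∀ j, (w j).re ≠ 0 → (z k j).re ≠ 0 := by
      rw [eventually_all]
      intro j
      by_cases h : (w j).re = 0
      · simp [h]
      · have : Tendsto (fun k => (z k j).re) atTop (𝓝 (w j).re) :=
          (Complex.continuous_re.tendsto _).comp (hzj j)
        filter_upwards [this.eventually_ne h] with k hk _ using hk
    obtain ⟨k, hk⟩ := hev.exists
    rw [hcount k]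
    apply Finset.card_le_card
    intro j hj
    rw [Finset.mem_filter] at hj ⊢
    exact ⟨hj.1, by_contra fun h => hk j h hj.2⟩
  -- The reflection of `z k j` is again an eigenvalue, and it tends to `w j`. If no other index has
  -- this limit, the reflection is eventually `z k j` itself, which is then imaginary.
  · have hev : ∀ᶠ k in atTop, ∀ j j', (w j).re = 0 → w j' ≠ w j →
        z k j' ≠ -(starRingEnd ℂ (z k j)) := by
      rw [eventually_all]
      intro j
      rw [eventually_all]
      intro j'
      by_cases h : (w j).re = 0 ∧ w j' ≠ w j
      · have h1 : Tendsto (fun k => z k j' - -(starRingEnd ℂ (z k j))) atTop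
            (𝓝 (w j' - -(starRingEnd ℂ (w j)))) :=
          (hzj j').sub (((Complex.continuous_conj.tendsto _).comp (hzj j)).neg)
        have h2 : -(starRingEnd ℂ (w j)) = w j := by
          apply Complex.ext <;> simp [h.1]
        rw [h2] at h1
        filter_upwards [h1.eventually_ne (sub_ne_zero.2 h.2)] with k hk _ _ using sub_ne_zero.1 hk
      · exact Eventually.of_forall fun k h1 h2 => absurd ⟨h1, h2⟩ h
    obtain ⟨k, hk⟩ := hev.exists
    rw [hcount k]
    apply Finset.card_le_card
    intro j hj
    rw [Finset.mem_filter] at hj ⊢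
    refine ⟨hj.1, ?_⟩
    have hmem : z k j ∈ ((B (φ k)).map (algebraMap ℝ ℂ)).charpoly.roots := by
      rw [hz k]
      exact Multiset.mem_map.2 ⟨j, Finset.mem_univ_val j, rfl⟩
    have hmem' := neg_conj_mem_roots (col := col) (fun i i' h => hcol i i' (by
      rw [← hB (φ k) i i']
      exact sign_ne_zero.2 h)) hmem
    rw [hz k, Multiset.mem_map] at hmem'
    obtain ⟨j', -, hj'⟩ := hmem'
    by_cases hjj : j' = j
    · rw [hjj] at hj'
      have := congrArg Complex.re hj'
      simp only [Complex.neg_re, Complex.conj_re] at this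
      linarith
    · exact absurd hj' (hk j j' hj.2.1 (hj.2.2 j' hjj))

lemma InClosure.add_card_le {P : SignPattern n} {t : ℕ × ℕ × ℕ} (ht : P.inertiaSet = {t})
    {A : Matrix (Fin n) (Fin n) ℝ} (hA : P.InClosure A) (Z : Finset ℂ)
    (hZ : ∀ z ∈ Z, z ∈ (A.map (algebraMap ℝ ℂ)).charpoly.roots ∧ z.re ≠ 0) :
    t.2.2 + Z.card ≤ n := by
  classical
  obtain ⟨w, hw, h1, -⟩ := hA.exists_roots ht
  have h2 : Z.card ≤ (Finset.univ.filter fun j => ¬ (w j).re = 0).card := by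
    refine (Finset.card_le_card ?_).trans (Finset.card_image_le (f := w))
    intro z hz
    obtain ⟨hz1, hz2⟩ := hZ z hz
    rw [hw, Multiset.mem_map] at hz1
    obtain ⟨j, -, rfl⟩ := hz1
    exact Finset.mem_image_of_mem _ (by simpa using hz2)
  have h3 := Finset.card_filter_add_card_filter_not (s := (Finset.univ : Finset (Fin n)))
    (fun j => (w j).re = 0)
  rw [Finset.card_univ, Fintype.card_fin] at h3
  omega

lemma InClosure.card_le {P : SignPattern n} {t : ℕ × ℕ × ℕ} (ht : P.inertiaSet = {t})
    {A : Matrix (Fin n) (Fin n) ℝ} (hA : P.InClosure A) {col : Fin n → Bool}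
    (hcol : ∀ i j, P i j ≠ 0 → col i ≠ col j) (Z : Finset ℂ)
    (hZ : ∀ z ∈ Z, (A.map (algebraMap ℝ ℂ)).charpoly.roots.count z = 1 ∧ z.re = 0) :
    Z.card ≤ t.2.2 := by
  classical
  obtain ⟨w, hw, -, h1⟩ := hA.exists_roots ht
  refine le_trans ?_ (h1 col hcol)
  refine (Finset.card_le_card ?_).trans (Finset.card_image_le (f := w))
  intro z hz
  obtain ⟨hz1, hz2⟩ := hZ z hz
  rw [hw, Multiset.count_map] at hz1
  have hz1' : (Finset.univ.filter fun j => z = w j).card = 1 := hz1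
  obtain ⟨j, hj⟩ := Finset.card_eq_one.1 hz1'
  have hmem : ∀ j', z = w j' ↔ j' = j := by
    intro j'
    have := Finset.ext_iff.1 hj j'
    simpa using this
  have hzj := (hmem j).2 rfl
  refine Finset.mem_image.2 ⟨j, ?_, hzj.symm⟩
  rw [Finset.mem_filter]
  refine ⟨Finset.mem_univ _, by rwa [← hzj], fun j' hj' h => hj' ((hmem j').1 ?_)⟩
  rw [h, hzj]

end SignPattern

end Limits

/-! ### Eigenvalues of matrices supported on pairs -/

section Eigenvalues

open Matrix

variable {n : ℕ}

lemma mem_roots_of_mulVec_eq {A : Matrix (Fin n) (Fin n) ℂ} {z : ℂ} {x : Fin n → ℂ}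
    (hx : x ≠ 0) (h : A *ᵥ x = z • x) : z ∈ A.charpoly.roots := by
  rw [Polynomial.mem_roots (Matrix.charpoly_monic _).ne_zero, Polynomial.IsRoot,
    Matrix.eval_charpoly, ← Matrix.exists_mulVec_eq_zero_iff]
  refine ⟨x, hx, ?_⟩
  rw [Matrix.sub_mulVec, h, Matrix.scalar_apply, ← Matrix.smul_one_eq_diagonal, Matrix.smul_mulVec,
    Matrix.one_mulVec, sub_self]

/-- The hypotheses on columns `v` and `v'` make the plane of these two coordinates invariant,
whatever the other columns are. -/
lemma mem_roots_of_pair {A : Matrix (Fin n) (Fin n) ℂ} {v v' : Fin n} (hv : v ≠ v')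
    (h : ∀ u, A u v ≠ 0 → u = v') (h' : ∀ u, A u v' ≠ 0 → u = v) {z : ℂ} (hz : z ≠ 0)
    (hz2 : z ^ 2 = A v v' * A v' v) : z ∈ A.charpoly.roots := by
  refine mem_roots_of_mulVec_eq (x := Pi.single v z + Pi.single v' (A v' v)) ?_ ?_
  · intro h0
    have := congrFun h0 v
    simp [hv, hz] at this
  · rw [Matrix.mulVec_add, Matrix.mulVec_single, Matrix.mulVec_single]
    ext u
    simp only [Pi.add_apply, Pi.smul_apply, Matrix.col_apply, smul_eq_mul, MulOpposite.smul_eq_mul_unop,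
      MulOpposite.unop_op]
    by_cases h1 : u = v
    · subst h1
      have : A u u = 0 := by_contra fun h0 => hv (h u h0)
      simp [this, hv, ← hz2]
      ring
    · by_cases h2 : u = v'
      · subst h2
        have : A u u = 0 := by_contra fun h0 => hv (h' u h0).symm
        simp [this, h1]
        ring
      · have e1 : A u v = 0 := by_contra fun h0 => h2 (h u h0)
        have e2 : A u v' = 0 := by_contra fun h0 => h1 (h' u h0)
        simp [e1, e2, h1, h2]

/-- By bipartiteness `det (x - A) = det (x + A)`, so the square of the characteristic polynomial is
`det (x² - A²)`. The square accounts for the factor 2. -/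
lemma two_nsmul_roots_charpoly {A : Matrix (Fin n) (Fin n) ℂ} {col : Fin n → Bool}
    (hcol : ∀ i j, A i j ≠ 0 → col i ≠ col j) {l : Fin n → ℂ}
    (hA : A * A = Matrix.diagonal fun v => l v ^ 2) :
    2 • A.charpoly.roots = Finset.univ.val.map l + Finset.univ.val.map (fun v => -l v) := by
  have hp : A.charpoly ^ 2 = (∏ v, (Polynomial.X - Polynomial.C (l v))) *
      ∏ v, (Polynomial.X - Polynomial.C (-l v)) := by
    apply Polynomial.funext
    intro x
    rw [Polynomial.eval_pow, Matrix.eval_charpoly, Polynomial.eval_mul, Polynomial.eval_prod,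
      Polynomial.eval_prod, ← Finset.prod_mul_distrib]
    simp only [Polynomial.eval_sub, Polynomial.eval_X, Polynomial.eval_C]
    let d : Fin n → ℂ := fun i => if col i then 1 else -1
    have h1 : Matrix.scalar (Fin n) x + A =
        Matrix.diagonal d * (Matrix.scalar (Fin n) x - A) * Matrix.diagonal d := by
      ext i j
      rw [Matrix.mul_diagonal, Matrix.diagonal_mul]
      by_cases hij : i = j
      · subst hij
        have : A i i = 0 := by
          by_contra h
          exact hcol i i h rfl
        by_cases hi : col i <;> simp [d, this, hi]
      · by_cases hA : A i j = 0
        · simp [hij, hA]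
        · have := hcol i j hA
          by_cases hi : col i <;> by_cases hj : col j <;> simp_all [d]
    have hd : (Matrix.diagonal d).det * (Matrix.diagonal d).det = 1 := by
      rw [← Matrix.det_mul, Matrix.diagonal_mul_diagonal]
      have : (fun i => d i * d i) = fun _ => 1 := by
        ext i
        by_cases hi : col i <;> simp [d, hi]
      rw [this, Matrix.diagonal_one, Matrix.det_one]
    have h2 : (Matrix.scalar (Fin n) x + A).det = (Matrix.scalar (Fin n) x - A).det := by
      rw [h1, Matrix.det_mul, Matrix.det_mul, mul_right_comm, hd, one_mul]
    have h3 : (Matrix.scalar (Fin n) x - A) * (Matrix.scalar (Fin n) x + A) =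
        Matrix.diagonal fun v => (x - l v) * (x - -l v) := by
      have hc : Matrix.scalar (Fin n) x * A = A * Matrix.scalar (Fin n) x :=
        (Matrix.scalar_commute x (fun _ => Commute.all _ _) A).eq
      rw [sub_mul, mul_add, mul_add, hA, hc, Matrix.scalar_apply, Matrix.diagonal_mul_diagonal,
        add_comm _ (A * _), add_sub_add_left_eq_sub, Matrix.diagonal_sub]
      congr 1
      ext v
      ring
    rw [pow_two]
    nth_rewrite 2 [← h2]
    rw [← Matrix.det_mul, h3, Matrix.det_diagonal]
  have hr := congrArg Polynomial.roots hp
  rw [Polynomial.roots_pow, Polynomial.roots_mul] at hr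
  · rw [hr]
    have h1 := Polynomial.roots_multiset_prod_X_sub_C (Finset.univ.val.map l)
    have h2 := Polynomial.roots_multiset_prod_X_sub_C (Finset.univ.val.map fun v => -l v)
    rw [Multiset.map_map] at h1 h2
    exact congrArg₂ _ h1 h2
  · rw [← hp]
    exact pow_ne_zero _ (Matrix.charpoly_monic _).ne_zero

end Eigenvalues

/-! ### Weighted matchings and the bounds they give on `i₀` -/

section Matchings

open Matrix

variable {n : ℕ}

namespace SignPattern

/-- A square root of a sign. -/
noncomputable def sqrtSign (s : SignType) : ℂ :=
  if s = 1 then 1 else if s = -1 then Complex.I else 0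

lemma sqrtSign_sq (s : SignType) : sqrtSign s ^ 2 = ((s : ℝ) : ℂ) := by
  cases s <;> simp [sqrtSign]

lemma norm_sqrtSign {s : SignType} (hs : s ≠ 0) : ‖sqrtSign s‖ = 1 := by
  cases s <;> simp_all [sqrtSign]

lemma sqrtSign_zero : sqrtSign 0 = 0 := by
  simp [sqrtSign]

/-- Distinct positive weights for the pairs of an involution. -/
noncomputable def pairWeight (m : Fin n → Fin n) (v : Fin n) : ℝ :=
  ((min v (m v) : Fin n) : ℝ) + 2

/-- The strict bound separates these eigenvalues from the one of modulus 1 that a rotated cycle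
contributes in `cycle_add_card_pos_le`. -/
lemma one_lt_pairWeight (m : Fin n → Fin n) (v : Fin n) : 1 < pairWeight m v := by
  unfold pairWeight
  have : (0 : ℝ) ≤ ((min v (m v) : Fin n) : ℝ) := Nat.cast_nonneg _
  linarith

lemma pairWeight_apply {m : Fin n → Fin n} (hm : ∀ v, m (m v) = v) (v : Fin n) :
    pairWeight m (m v) = pairWeight m v := by
  unfold pairWeight
  rw [hm, min_comm]

lemma eq_or_eq_of_pairWeight_eq {m : Fin n → Fin n} (hm : ∀ v, m (m v) = v) {u v : Fin n}
    (h : pairWeight m u = pairWeight m v) : u = v ∨ u = m v := by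
  unfold pairWeight at h
  have h' : min u (m u) = min v (m v) := by
    apply Fin.ext
    have := add_right_cancel h
    exact_mod_cast this
  rcases min_choice u (m u) with h1 | h1 <;> rcases min_choice v (m v) with h2 | h2 <;>
    rw [h1, h2] at h'
  · exact Or.inl h'
  · exact Or.inr h'
  · right
    rw [← h', hm]
  · left
    rw [← hm u, h', hm]

/-- The sign of the edge between `v` and `m v`. -/
def pairSign (P : SignPattern n) (m : Fin n → Fin n) (v : Fin n) : SignType :=
  P v (m v) * P (m v) v

lemma pairSign_apply (P : SignPattern n) {m : Fin n → Fin n} (hm : ∀ v, m (m v) = v)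
    (v : Fin n) : P.pairSign m (m v) = P.pairSign m v := by
  unfold pairSign
  rw [hm, mul_comm]

/-- A square root of the product of the two entries of `pairMatrix` at the pair of `v`. -/
noncomputable def pairRoot (P : SignPattern n) (m : Fin n → Fin n) (v : Fin n) : ℂ :=
  sqrtSign (P.pairSign m v) * pairWeight m v

/-- The eigenvalues belonging to the pairs of `m`. -/
noncomputable def pairEigenvalue (P : SignPattern n) (m : Fin n → Fin n) (v : Fin n) : ℂ :=
  -- The two vertices of a pair take opposite square roots, so that counting vertices counts
  -- eigenvalues.
  if v < m v then P.pairRoot m v else -P.pairRoot m v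

lemma norm_pairRoot (P : SignPattern n) {m : Fin n → Fin n} {v : Fin n}
    (h : P.pairSign m v ≠ 0) : ‖P.pairRoot m v‖ = pairWeight m v := by
  rw [pairRoot, norm_mul, norm_sqrtSign h, one_mul, Complex.norm_real, Real.norm_eq_abs, abs_of_pos]
  exact zero_lt_one.trans (one_lt_pairWeight m v)

lemma norm_pairEigenvalue (P : SignPattern n) {m : Fin n → Fin n} {v : Fin n}
    (h : P.pairSign m v ≠ 0) : ‖P.pairEigenvalue m v‖ = pairWeight m v := by
  rw [pairEigenvalue]
  split_ifs
  · exact norm_pairRoot P h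
  · rw [norm_neg, norm_pairRoot P h]

lemma pairRoot_ne_zero (P : SignPattern n) {m : Fin n → Fin n} {v : Fin n}
    (h : P.pairSign m v ≠ 0) : P.pairRoot m v ≠ 0 := by
  rw [← norm_pos_iff, norm_pairRoot P h]
  exact zero_lt_one.trans (one_lt_pairWeight m v)

lemma pairRoot_apply (P : SignPattern n) {m : Fin n → Fin n} (hm : ∀ v, m (m v) = v)
    (v : Fin n) : P.pairRoot m (m v) = P.pairRoot m v := by
  unfold pairRoot
  rw [pairSign_apply P hm, pairWeight_apply hm]

lemma eq_or_eq_of_norm_pairRoot_eq (P : SignPattern n) {m : Fin n → Fin n}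
    (hm : ∀ v, m (m v) = v) {u v : Fin n} (hv : P.pairSign m v ≠ 0)
    (h : ‖P.pairRoot m u‖ = ‖P.pairRoot m v‖) : u = v ∨ u = m v := by
  have hu : P.pairSign m u ≠ 0 := by
    intro h0
    rw [pairRoot, h0, sqrtSign_zero, zero_mul, norm_zero, eq_comm, norm_eq_zero] at h
    exact pairRoot_ne_zero P hv h
  rw [norm_pairRoot P hu, norm_pairRoot P hv] at h
  exact eq_or_eq_of_pairWeight_eq hm h

lemma apply_ne_of_pairSign_ne_zero {P : SignPattern n} (hdiag : P.ZeroDiagonal)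
    {m : Fin n → Fin n} {v : Fin n} (h : P.pairSign m v ≠ 0) : m v ≠ v := by
  intro h0
  apply h
  rw [pairSign, h0, hdiag v, zero_mul]

lemma pairEigenvalue_injOn {P : SignPattern n} (hdiag : P.ZeroDiagonal) {m : Fin n → Fin n}
    (hm : ∀ v, m (m v) = v) {u v : Fin n} (hu : P.pairSign m u ≠ 0) (hv : P.pairSign m v ≠ 0)
    (h : P.pairEigenvalue m u = P.pairEigenvalue m v) : u = v := by
  have h1 := congrArg norm h
  rw [norm_pairEigenvalue P hu, norm_pairEigenvalue P hv] at h1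
  rcases eq_or_eq_of_pairWeight_eq hm h1 with h2 | h2
  · exact h2
  · exfalso
    have hne := apply_ne_of_pairSign_ne_zero hdiag hv
    have h0 := pairRoot_ne_zero P hv
    rw [h2, pairEigenvalue, pairEigenvalue, hm, pairRoot_apply P hm] at h
    rcases lt_or_gt_of_ne hne with h3 | h3
    · rw [if_pos h3, if_neg h3.not_gt, self_eq_neg] at h
      exact h0 h
    · rw [if_neg h3.not_gt, if_pos h3, neg_eq_self] at h
      exact h0 h

lemma pairEigenvalue_re_of_neg {P : SignPattern n} {m : Fin n → Fin n} {v : Fin n}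
    (h : P.pairSign m v = -1) : (P.pairEigenvalue m v).re = 0 := by
  unfold pairEigenvalue pairRoot
  rw [h]
  split_ifs <;> simp [sqrtSign]

lemma pairEigenvalue_re_of_pos {P : SignPattern n} {m : Fin n → Fin n} {v : Fin n}
    (h : P.pairSign m v = 1) : (P.pairEigenvalue m v).re ≠ 0 := by
  have := one_lt_pairWeight m v
  unfold pairEigenvalue pairRoot
  rw [h]
  split_ifs <;> simp [sqrtSign] <;> linarith

lemma pairRoot_sq (P : SignPattern n) (m : Fin n → Fin n) (v : Fin n) :
    P.pairRoot m v ^ 2 = (((P v (m v) : ℝ) * pairWeight m v : ℝ) : ℂ) *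
      (((P (m v) v : ℝ) * pairWeight m v : ℝ) : ℂ) := by
  rw [pairRoot, mul_pow, sqrtSign_sq, pairSign, SignType.coe_mul]
  push_cast
  ring

lemma pairEigenvalue_sq (P : SignPattern n) (m : Fin n → Fin n) (v : Fin n) :
    P.pairEigenvalue m v ^ 2 = P.pairRoot m v ^ 2 := by
  unfold pairEigenvalue
  split_ifs <;> ring

/-- The matrix with the signs of `P` that is supported on the pairs of `m`. -/
noncomputable def pairMatrix (P : SignPattern n) (m : Fin n → Fin n) :
    Matrix (Fin n) (Fin n) ℝ :=
  Matrix.of fun v u => if u = m v then (P v u : ℝ) * pairWeight m v else 0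

lemma pairMatrix_inClosure (P : SignPattern n) (m : Fin n → Fin n) :
    P.InClosure (P.pairMatrix m) := by
  intro v u
  rw [pairMatrix, Matrix.of_apply]
  split_ifs with h
  · right
    rw [mul_comm, sign_mul_coe (zero_lt_one.trans (one_lt_pairWeight m v))]
  · exact Or.inl rfl

/-- The matrix squares to a diagonal one. In its doubled spectrum the value occurs exactly twice,
from `v` and `m v`, because distinct pairs have distinct moduli. -/
lemma count_roots_pairMatrix {P : SignPattern n} (hdiag : P.ZeroDiagonal) {m : Fin n → Fin n}
    (hm : ∀ v, m (m v) = v) {col : Fin n → Bool} (hcol : ∀ i j, P i j ≠ 0 → col i ≠ col j)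
    {v : Fin n} (hv : P.pairSign m v ≠ 0) :
    ((P.pairMatrix m).map (algebraMap ℝ ℂ)).charpoly.roots.count (P.pairEigenvalue m v) = 1 := by
  have hsq : (P.pairMatrix m).map (algebraMap ℝ ℂ) * (P.pairMatrix m).map (algebraMap ℝ ℂ) =
      Matrix.diagonal fun v => P.pairRoot m v ^ 2 := by
    ext v u
    rw [Matrix.mul_apply, Finset.sum_eq_single (m v)]
    · by_cases hvu : v = u
      · subst hvu
        rw [Matrix.diagonal_apply_eq, pairRoot_sq]
        simp [pairMatrix, hm, pairWeight_apply hm]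
      · rw [Matrix.diagonal_apply_ne _ hvu]
        simp [pairMatrix, hm, Ne.symm hvu]
    · intro w _ hw
      simp [pairMatrix, hw]
    · simp
  have h2 := congrArg (Multiset.count (P.pairEigenvalue m v))
    (two_nsmul_roots_charpoly (A := (P.pairMatrix m).map (algebraMap ℝ ℂ)) (col := col)
      (fun i j h => hcol i j (by
        rintro h0
        apply h
        simp [pairMatrix, h0])) hsq)
  rw [Multiset.count_nsmul, Multiset.count_add, Multiset.count_map, Multiset.count_map] at h2
  have h0 := pairRoot_ne_zero P hv
  have hne := apply_ne_of_pairSign_ne_zero hdiag hv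
  have key : ∀ u, (P.pairRoot m v = P.pairRoot m u ↔ u ∈ ({v, m v} : Finset (Fin n))) := by
    intro u
    rw [Finset.mem_insert, Finset.mem_singleton]
    constructor
    · intro h
      exact eq_or_eq_of_norm_pairRoot_eq P hm hv (by rw [h])
    · rintro (rfl | rfl)
      · rfl
      · rw [pairRoot_apply P hm]
  have key' : ∀ u, P.pairRoot m v ≠ -P.pairRoot m u := by
    intro u h
    have h1 := eq_or_eq_of_norm_pairRoot_eq P hm hv (u := u) (by rw [h, norm_neg])
    have h3 := (key u).2 (by simpa using h1)
    rw [← h3, self_eq_neg] at h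
    exact h0 h
  have c1 : (Finset.univ.filter fun u => P.pairRoot m v = P.pairRoot m u).card = 2 := by
    rw [← Finset.card_pair hne.symm]
    congr 1
    ext u
    rw [Finset.mem_filter]
    simp only [Finset.mem_univ, true_and]
    exact key u
  have c2 : (Finset.univ.filter fun u => P.pairRoot m v = -P.pairRoot m u).card = 0 := by
    rw [Finset.card_eq_zero, Finset.filter_eq_empty_iff]
    exact fun u _ => key' u
  simp only [Finset.card_def, Finset.filter_val] at c1 c2
  unfold pairEigenvalue at h2 ⊢
  split_ifs at h2 ⊢ with hlt
  · rw [c1, c2] at h2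
    omega
  · simp only [neg_eq_iff_eq_neg, neg_neg] at h2
    rw [c1, c2] at h2
    omega

/-- The negative edges of a matching force imaginary eigenvalues. -/
lemma card_neg_le {P : SignPattern n} (hdiag : P.ZeroDiagonal) {t : ℕ × ℕ × ℕ}
    (ht : P.inertiaSet = {t}) {m : Fin n → Fin n} (hm : ∀ v, m (m v) = v) {col : Fin n → Bool}
    (hcol : ∀ i j, P i j ≠ 0 → col i ≠ col j) :
    (Finset.univ.filter fun v => P.pairSign m v = -1).card ≤ t.2.2 := by
  classical
  rw [← Finset.card_image_of_injOn (f := P.pairEigenvalue m)]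
  · apply (pairMatrix_inClosure P m).card_le ht hcol
    intro z hz
    obtain ⟨v, hv, rfl⟩ := Finset.mem_image.1 hz
    rw [Finset.mem_filter] at hv
    exact ⟨count_roots_pairMatrix hdiag hm hcol (by rw [hv.2]; decide),
      pairEigenvalue_re_of_neg hv.2⟩
  · intro u hu v hv h
    simp only [Finset.coe_filter, Finset.mem_univ, true_and, Set.mem_ofPred_eq] at hu hv
    exact pairEigenvalue_injOn hdiag hm (by rw [hu]; decide) (by rw [hv]; decide) h

/-- The positive edges of a matching force eigenvalues off the imaginary axis. -/
lemma add_card_pos_le {P : SignPattern n} (hdiag : P.ZeroDiagonal) {t : ℕ × ℕ × ℕ}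
    (ht : P.inertiaSet = {t}) {m : Fin n → Fin n} (hm : ∀ v, m (m v) = v) {col : Fin n → Bool}
    (hcol : ∀ i j, P i j ≠ 0 → col i ≠ col j) :
    t.2.2 + (Finset.univ.filter fun v => P.pairSign m v = 1).card ≤ n := by
  classical
  rw [← Finset.card_image_of_injOn (f := P.pairEigenvalue m)]
  · apply (pairMatrix_inClosure P m).add_card_le ht
    intro z hz
    obtain ⟨v, hv, rfl⟩ := Finset.mem_image.1 hz
    rw [Finset.mem_filter] at hv
    refine ⟨?_, pairEigenvalue_re_of_pos hv.2⟩
    rw [← Multiset.count_pos, count_roots_pairMatrix hdiag hm hcol (by rw [hv.2]; decide)]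
    exact one_pos
  · intro u hu v hv h
    simp only [Finset.coe_filter, Finset.mem_univ, true_and, Set.mem_ofPred_eq] at hu hv
    exact pairEigenvalue_injOn hdiag hm (by rw [hu]; decide) (by rw [hv]; decide) h

end SignPattern

end Matchings

/-! ### Cycles as permutations, and their two matchings -/

section CyclePermutations

set_option linter.unusedSectionVars false

variable {V : Type*} [DecidableEq V] {G : SimpleGraph V}

/-- In a bipartite graph, a permutation along edges splits into two matchings. This is one of
them. -/
def bicolorInvolution (col : V → Bool) (σ : Equiv.Perm V) (v : V) : V :=
  if col v then σ v else σ.symm v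

lemma bicolorInvolution_involutive {col : V → Bool} (hcol : ∀ x y, G.Adj x y → col x ≠ col y)
    {σ : Equiv.Perm V} (hσ : ∀ v, σ v = v ∨ G.Adj v (σ v)) (v : V) :
    bicolorInvolution col σ (bicolorInvolution col σ v) = v := by
  unfold bicolorInvolution
  by_cases hv : col v
  · rw [if_pos hv]
    rcases hσ v with h | h
    · rw [h, if_pos hv, h]
    · have := hcol _ _ h
      rw [if_neg (by simp_all)]
      simp
  · rw [if_neg hv]
    rcases hσ (σ.symm v) with h | h
    · rw [Equiv.apply_symm_apply] at h
      rw [← h, if_neg hv, ← h]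
    · have := hcol _ _ h
      rw [Equiv.apply_symm_apply] at this
      rw [if_pos (by simp_all)]
      simp

lemma IsCycle.rotation_properties {a : V} {c : G.Walk a a} (hc : c.IsCycle) {ρ : Equiv.Perm V}
    (hρ : ∀ i < c.length, ρ (c.getVert i) = c.getVert (i + 1)) :
    (∀ v, ρ v ∈ c.support ↔ v ∈ c.support) ∧ (∀ v ∈ c.support, s(v, ρ v) ∈ c.edges) ∧
      (∀ v ∈ c.support, ρ (ρ v) ≠ v) ∧
      ∀ x y, s(x, y) ∈ c.edges → ρ x = y ∨ ρ y = x := by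
  have h3 := hc.three_le_length
  have hlast : c.getVert c.length = c.getVert 0 := by simp
  have hmem : ∀ v ∈ c.support, ρ v ∈ c.support := by
    intro v hv
    obtain ⟨i, hi, rfl⟩ := (isCycle_mem_support_iff hc).1 hv
    rw [hρ i hi]
    exact c.getVert_mem_support _
  refine ⟨fun v => ⟨fun hv => ?_, hmem v⟩, fun v hv => ?_, fun v hv h => ?_, fun x y h => ?_⟩
  · obtain ⟨i, hi, h⟩ := (isCycle_mem_support_iff hc).1 hv
    rcases i with _ | i
    · have h0 := hρ (c.length - 1) (by omega)
      rw [Nat.sub_add_cancel (by omega), hlast, h] at h0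
      rw [← ρ.injective h0]
      exact c.getVert_mem_support _
    · rw [← hρ i (by omega)] at h
      rw [← ρ.injective h]
      exact c.getVert_mem_support _
  · obtain ⟨i, hi, rfl⟩ := (isCycle_mem_support_iff hc).1 hv
    rw [hρ i hi, walk_edges_eq_map_range]
    exact List.mem_map.2 ⟨i, by simpa using hi, rfl⟩
  · obtain ⟨i, hi, rfl⟩ := (isCycle_mem_support_iff hc).1 hv
    rw [hρ i hi] at h
    have hinj : ∀ i < c.length, ∀ j < c.length, c.getVert i = c.getVert j → i = j :=
      fun i hi j hj hij => hc.getVert_injOn'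
        (by simp only [Set.mem_ofPred_eq]; omega) (by simp only [Set.mem_ofPred_eq]; omega) hij
    by_cases h1 : i + 1 = c.length
    · rw [h1, hlast, hρ 0 (by omega)] at h
      have := hinj _ (by omega) _ hi h
      omega
    · rw [hρ (i + 1) (by omega)] at h
      by_cases h2 : i + 2 = c.length
      · rw [show i + 1 + 1 = c.length by omega, hlast] at h
        have := hinj _ (by omega) _ hi h
        omega
      · have := hinj _ (by omega) _ hi h
        omega
  · rw [walk_edges_eq_map_range, List.mem_map] at h
    obtain ⟨i, hi, h⟩ := h
    rw [List.mem_range] at hi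
    rw [← hρ i hi, Sym2.eq_iff] at h
    rcases h with ⟨rfl, h⟩ | ⟨rfl, h⟩
    · exact Or.inl h
    · exact Or.inr h

/-- The two perfect matchings that extend those of an even cycle by a common matching of the
other vertices. -/
lemma exists_matchings_of_cycle [Fintype V] (hG : OddCycleDist G) (hdeg0 : ∀ v, ∃ a, G.Adj v a)
    (hdeg : ∀ x a, G.Adj x a → ∃ b, b ≠ a ∧ G.Adj x b) {col : V → Bool}
    (hcol : ∀ x y, G.Adj x y → col x ≠ col y) {a : V} {c : G.Walk a a} (hc : c.IsCycle) :
    ∃ m₀ m₁ m₂ : V → V, (∀ v, m₀ (m₀ v) = v) ∧ (∀ v, m₁ (m₁ v) = v) ∧ (∀ v, m₂ (m₂ v) = v) ∧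
      (∀ v ∈ c.support, m₀ v = v) ∧
      (∀ v ∉ c.support, m₁ v = m₀ v ∧ m₂ v = m₀ v ∧ G.Adj v (m₀ v)) ∧
      (∀ v ∈ c.support, s(v, m₁ v) ∈ c.edges ∧ s(v, m₂ v) ∈ c.edges ∧ m₁ v ≠ m₂ v) ∧
      ∀ x y, s(x, y) ∈ c.edges → m₁ x = y ∨ m₂ x = y := by
  obtain ⟨h, h1, h2⟩ := exists_perm_off_cycle hG hdeg0 hdeg hc
  obtain ⟨ρ, hρ, hρ'⟩ := exists_rotation hc
  obtain ⟨r1, r2, r3, r4⟩ := IsCycle.rotation_properties hc hρ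
  have h1' : ∀ v ∈ c.support, h.symm v = v := fun v hv => by
    rw [Equiv.symm_apply_eq, h1 v hv]
  have hρ'' : ∀ v ∉ c.support, ρ.symm v = v := fun v hv => by
    rw [Equiv.symm_apply_eq, hρ' v hv]
  have r1' : ∀ v, ρ.symm v ∈ c.support ↔ v ∈ c.support := fun v => by
    rw [← r1 (ρ.symm v), Equiv.apply_symm_apply]
  have hout : ∀ v ∉ c.support, h v ∉ c.support := fun v hv hc' => by
    have := h.injective (h1 _ hc')
    exact hv (this ▸ hc')
  have r2' : ∀ v ∈ c.support, s(v, ρ.symm v) ∈ c.edges := fun v hv => by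
    have := r2 _ ((r1' v).2 hv)
    rwa [Equiv.apply_symm_apply, Sym2.eq_swap] at this
  have hne : ∀ v ∈ c.support, ρ v ≠ ρ.symm v := fun v hv he => by
    apply r3 v hv
    rw [he, Equiv.apply_symm_apply]
  have e1 : ∀ v ∈ c.support, bicolorInvolution col (ρ * h) v = bicolorInvolution col ρ v := by
    intro v hv
    simp [bicolorInvolution, Equiv.Perm.mul_def, h1 v hv, h1' _ ((r1' v).2 hv)]
  have e2 : ∀ v ∈ c.support, bicolorInvolution col (ρ.symm * h) v =
      bicolorInvolution col ρ.symm v := by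
    intro v hv
    simp [bicolorInvolution, Equiv.Perm.mul_def, h1 v hv, h1' _ ((r1 v).2 hv)]
  -- Off the cycle all three come from `h`. On it, `h` leaves the vertices unmatched, while `ρ` and
  -- `ρ.symm` select complementary halves of its edges.
  refine ⟨bicolorInvolution col h, bicolorInvolution col (ρ * h), bicolorInvolution col (ρ.symm * h),
    bicolorInvolution_involutive hcol fun v => ?_, bicolorInvolution_involutive hcol fun v => ?_,
    bicolorInvolution_involutive hcol fun v => ?_, fun v hv => ?_, fun v hv => ⟨?_, ?_, ?_⟩,
    fun v hv => ?_, fun x y hxy => ?_⟩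
  · by_cases hv : v ∈ c.support
    · exact Or.inl (h1 v hv)
    · exact Or.inr (h2 v hv)
  · right
    rw [Equiv.Perm.mul_apply]
    by_cases hv : v ∈ c.support
    · rw [h1 v hv]
      exact c.adj_of_mem_edges (r2 v hv)
    · rw [hρ' _ (hout v hv)]
      exact h2 v hv
  · right
    rw [Equiv.Perm.mul_apply]
    by_cases hv : v ∈ c.support
    · rw [h1 v hv]
      exact c.adj_of_mem_edges (r2' v hv)
    · rw [hρ'' _ (hout v hv)]
      exact h2 v hv
  · simp [bicolorInvolution, h1 v hv, h1' v hv]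
  · simp [bicolorInvolution, Equiv.Perm.mul_def, hρ' _ (hout v hv), hρ'' v hv]
  · simp [bicolorInvolution, Equiv.Perm.mul_def, hρ'' _ (hout v hv), hρ' v hv]
  · unfold bicolorInvolution
    split_ifs
    · exact h2 v hv
    · have : h.symm v ∉ c.support := fun hc' => hv (by
        have := h1 _ hc'
        rw [Equiv.apply_symm_apply] at this
        rwa [this])
      have := h2 _ this
      rw [Equiv.apply_symm_apply] at this
      exact this.symm
  · rw [e1 v hv, e2 v hv]
    unfold bicolorInvolution
    split_ifs
    · exact ⟨r2 v hv, r2' v hv, hne v hv⟩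
    · rw [Equiv.symm_symm]
      exact ⟨r2' v hv, r2 v hv, (hne v hv).symm⟩
  · have hx : x ∈ c.support := c.fst_mem_support_of_mem_edges hxy
    rw [e1 x hx, e2 x hx]
    have : ρ x = y ∨ ρ.symm x = y := by
      rcases r4 x y hxy with h | h
      · exact Or.inl h
      · right
        rw [Equiv.symm_apply_eq, h]
    unfold bicolorInvolution
    split_ifs
    · exact this
    · rw [Equiv.symm_symm]
      exact this.symm

lemma prod_support_eq {M : Type*} [CommMonoid M] {a : V} {c : G.Walk a a} (hc : c.IsCycle)
    {ρ : Equiv.Perm V} (hρ : ∀ i < c.length, ρ (c.getVert i) = c.getVert (i + 1))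
    (F : Sym2 V → M) : ∏ v ∈ c.support.toFinset, F s(v, ρ v) = (c.edges.map F).prod := by
  have himg : c.support.toFinset = (Finset.range c.length).image c.getVert := by
    ext v
    rw [List.mem_toFinset, isCycle_mem_support_iff hc]
    simp
  rw [himg, Finset.prod_image, walk_edges_eq_map_range, List.map_map]
  · rw [Finset.prod_congr rfl fun i hi => by rw [hρ i (Finset.mem_range.1 hi)]]
    rfl
  · intro i hi j hj hij
    simp only [Finset.coe_range, Set.mem_Iio] at hi hj
    exact hc.getVert_injOn' (by simp only [Set.mem_ofPred_eq]; omega)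
      (by simp only [Set.mem_ofPred_eq]; omega) hij

end CyclePermutations

/-! ### Matrices supported on a rotated cycle or a permutation -/

section CycleRoots

open Matrix

variable {n : ℕ}

namespace SignPattern

lemma coe_mul_self {s : SignType} (hs : s ≠ 0) : ((s : ℝ) : ℂ) * ((s : ℝ) : ℂ) = 1 := by
  cases s <;> simp_all

/-- For `s = -1` the root `exp (iπ/k)` works, since `π/k < π/2`; for `k = 2` both roots would be
imaginary. -/
lemma exists_root_of_sq_eq_one {k : ℕ} (hk : 3 ≤ k) {s : ℂ} (hs : s * s = 1) :
    ∃ z : ℂ, z ^ k = s ∧ ‖z‖ = 1 ∧ z.re ≠ 0 := by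
  rcases mul_self_eq_one_iff.1 hs with rfl | rfl
  · exact ⟨1, by simp⟩
  · refine ⟨Complex.exp ((Real.pi / k : ℝ) * Complex.I), ?_, Complex.norm_exp_ofReal_mul_I _, ?_⟩
    · rw [← Complex.exp_nat_mul, ← mul_assoc]
      have : (k : ℂ) * ((Real.pi / k : ℝ) : ℂ) = Real.pi := by
        have : (k : ℂ) ≠ 0 := by
          have : k ≠ 0 := by omega
          exact_mod_cast this
        push_cast
        field_simp
      rw [this, Complex.exp_pi_mul_I]
    · rw [Complex.exp_ofReal_mul_I_re]
      apply ne_of_gt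
      have hk' : (3 : ℝ) ≤ k := by exact_mod_cast hk
      have hpi := Real.pi_pos
      apply Real.cos_pos_of_mem_Ioo
      constructor
      · have : 0 ≤ Real.pi / k := by positivity
        linarith
      · rw [div_lt_div_iff₀ (by linarith) two_pos]
        nlinarith

/-- A cycle that is rotated contributes an eigenvalue off the imaginary axis, in addition to those
of the positive edges of a matching of the other vertices. -/
lemma cycle_add_card_pos_le {P : SignPattern n} (hdiag : P.ZeroDiagonal) {t : ℕ × ℕ × ℕ}
    (ht : P.inertiaSet = {t}) {a : Fin n} {c : P.graph.Walk a a} (hc : c.IsCycle)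
    {m : Fin n → Fin n} (hm : ∀ v, m (m v) = v) (hmc : ∀ v ∈ c.support, m v = v) :
    t.2.2 + ((Finset.univ.filter fun v => P.pairSign m v = 1).card + 1) ≤ n := by
  classical
  obtain ⟨ρ, hρ, hρ'⟩ := exists_rotation hc
  obtain ⟨r1, r2, -, -⟩ := IsCycle.rotation_properties hc hρ
  have h3 := hc.three_le_length
  have hlast : c.getVert c.length = c.getVert 0 := by simp
  have hinj : ∀ i < c.length, ∀ j < c.length, c.getVert i = c.getVert j → i = j :=
    fun i hi j hj hij => hc.getVert_injOn'
      (by simp only [Set.mem_ofPred_eq]; omega) (by simp only [Set.mem_ofPred_eq]; omega) hij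
  let A : Matrix (Fin n) (Fin n) ℝ := Matrix.of fun v u =>
    if v ∈ c.support then (if u = ρ v then (P v u : ℝ) else 0) else P.pairMatrix m v u
  have hA : P.InClosure A := by
    intro v u
    change (if v ∈ c.support then (if u = ρ v then (P v u : ℝ) else 0) else P.pairMatrix m v u) = 0 ∨
      SignType.sign (if v ∈ c.support then (if u = ρ v then (P v u : ℝ) else 0)
        else P.pairMatrix m v u) = P v u
    split_ifs
    · right
      have := sign_mul_coe one_pos (P v u)
      rwa [one_mul] at this
    · exact Or.inl rfl
    · exact pairMatrix_inClosure P m v u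
  have hAin : ∀ v ∈ c.support, ∀ u, A v u = if u = ρ v then (P v u : ℝ) else 0 :=
    fun v hv u => if_pos hv
  have hAout : ∀ v ∉ c.support, ∀ u, A v u = P.pairMatrix m v u := fun v hv u => if_neg hv
  have hmout : ∀ v ∉ c.support, m v ∉ c.support := fun v hv h => hv (by
    have := hmc _ h
    rw [hm] at this
    rwa [this])
  let S : ℕ → ℂ := fun i => ((P (c.getVert i) (c.getVert (i + 1)) : ℝ) : ℂ)
  -- The cycle block has characteristic equation `z ^ c.length = Q c.length`. Its eigenvector is `z
  -- ^ i * Q i` at the `i`-th vertex, which closes up because `Q c.length` squares to 1.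
  let Q : ℕ → ℂ := fun i => ∏ j ∈ Finset.range i, S j
  have hS : ∀ i < c.length, S i * S i = 1 := by
    intro i hi
    apply coe_mul_self
    intro h0
    apply (c.adj_getVert_succ hi).2
    rw [h0, zero_mul]
  have hQ : ∀ i ≤ c.length, Q i * Q i = 1 := by
    intro i hi
    rw [← Finset.prod_mul_distrib]
    exact Finset.prod_eq_one fun j hj => hS j (by rw [Finset.mem_range] at hj; omega)
  obtain ⟨z, hz, hznorm, hzre⟩ := exists_root_of_sq_eq_one h3 (hQ _ le_rfl)
  have hz0 : z ∈ (A.map (algebraMap ℝ ℂ)).charpoly.roots := by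
    choose! g hg hg' using fun v (hv : v ∈ c.support) => (isCycle_mem_support_iff hc).1 hv
    let x : Fin n → ℂ := fun v => if v ∈ c.support then z ^ g v * Q (g v) else 0
    have hx : ∀ i ≤ c.length, x (c.getVert i) = z ^ i * Q i := by
      have hlt : ∀ i < c.length, x (c.getVert i) = z ^ i * Q i := by
        intro i hi
        have hmem := c.getVert_mem_support i
        have : g (c.getVert i) = i := hinj _ (hg _ hmem) _ hi (hg' _ hmem)
        simp only [x, if_pos hmem, this]
      intro i hi
      rcases hi.lt_or_eq with h | rfl
      · exact hlt i h
      · rw [hlast, hlt 0 (by omega), hz, hQ _ le_rfl]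
        simp [Q]
    apply mem_roots_of_mulVec_eq (x := x)
    · intro h0
      have := hx 0 (by omega)
      rw [h0] at this
      simp [Q] at this
    · ext v
      rw [Pi.smul_apply, smul_eq_mul, Matrix.mulVec, dotProduct]
      by_cases hv : v ∈ c.support
      · obtain ⟨i, hi, rfl⟩ := (isCycle_mem_support_iff hc).1 hv
        rw [Finset.sum_eq_single (ρ (c.getVert i))]
        · rw [Matrix.map_apply, hAin _ hv, if_pos rfl, hρ i hi, hx i hi.le, hx (i + 1) hi]
          have hs : Q (i + 1) = Q i * S i := Finset.prod_range_succ _ _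
          rw [hs, pow_succ]
          change S i * _ = _
          linear_combination (z ^ i * z * Q i) * hS i hi
        · intro u _ hu
          rw [Matrix.map_apply, hAin _ hv, if_neg hu]
          simp
        · simp
      · have hxv : ∀ u ∉ c.support, x u = 0 := fun u hu => if_neg hu
        rw [hxv v hv, mul_zero]
        apply Finset.sum_eq_zero
        intro u _
        rw [Matrix.map_apply, hAout v hv]
        by_cases hu : u = m v
        · rw [hxv u (hu ▸ hmout v hv), mul_zero]
        · simp [pairMatrix, hu]
  have hpos : ∀ v, P.pairSign m v = 1 →
      P.pairEigenvalue m v ∈ (A.map (algebraMap ℝ ℂ)).charpoly.roots := by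
    intro v hv
    have hv0 : P.pairSign m v ≠ 0 := by rw [hv]; decide
    have hne := apply_ne_of_pairSign_ne_zero hdiag hv0
    have hvc : v ∉ c.support := fun h => hne (hmc v h)
    have hcol : ∀ w ∉ c.support, ∀ u, (A.map (algebraMap ℝ ℂ)) u w ≠ 0 → u = m w := by
      intro w hw u hu
      rw [Matrix.map_apply] at hu
      by_cases huc : u ∈ c.support
      · exfalso
        apply hu
        rw [hAin u huc, if_neg]
        · simp
        · rintro rfl
          exact hw ((r1 u).2 huc)
      · by_contra hum
        apply hu
        rw [hAout u huc, pairMatrix, Matrix.of_apply, if_neg]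
        · simp
        · rintro rfl
          exact hum (hm u).symm
    apply mem_roots_of_pair hne.symm (hcol v hvc)
    · intro u hu
      rw [hcol _ (hmout v hvc) u hu, hm]
    · rw [← norm_pos_iff, norm_pairEigenvalue P hv0]
      exact zero_lt_one.trans (one_lt_pairWeight m v)
    · rw [pairEigenvalue_sq, pairRoot_sq, Matrix.map_apply, Matrix.map_apply, hAout v hvc,
        hAout _ (hmout v hvc)]
      simp [pairMatrix, hm, pairWeight_apply hm]
  have hcard := hA.add_card_le ht
    (insert z ((Finset.univ.filter fun v => P.pairSign m v = 1).image (P.pairEigenvalue m))) (by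
      intro y hy
      rw [Finset.mem_insert, Finset.mem_image] at hy
      rcases hy with rfl | ⟨v, hv, rfl⟩
      · exact ⟨hz0, hzre⟩
      · rw [Finset.mem_filter] at hv
        exact ⟨hpos v hv.2, pairEigenvalue_re_of_pos hv.2⟩)
  rwa [Finset.card_insert_of_notMem, Finset.card_image_of_injOn] at hcard
  · intro u hu v hv h
    simp only [Finset.coe_filter, Finset.mem_univ, true_and, Set.mem_ofPred_eq] at hu hv
    exact pairEigenvalue_injOn hdiag hm (by rw [hu]; decide) (by rw [hv]; decide) h
  · rw [Finset.mem_image]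
    rintro ⟨v, hv, rfl⟩
    rw [Finset.mem_filter] at hv
    rw [norm_pairEigenvalue P (by rw [hv.2]; decide)] at hznorm
    exact (one_lt_pairWeight m v).ne' hznorm

/-- The matrix with the signs of `P` that is supported on the permutation `σ`. -/
noncomputable def permutationMatrix (P : SignPattern n) (σ : Equiv.Perm (Fin n)) :
    Matrix (Fin n) (Fin n) ℝ :=
  Matrix.of fun v u => if u = σ v then (P v u : ℝ) else 0

lemma permutationMatrix_inClosure (P : SignPattern n) (σ : Equiv.Perm (Fin n)) :
    P.InClosure (P.permutationMatrix σ) := by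
  intro v u
  rw [permutationMatrix, Matrix.of_apply]
  split_ifs with h
  · right
    have := sign_mul_coe one_pos (P v u)
    rwa [one_mul] at this
  · exact Or.inl rfl

lemma det_permutationMatrix (P : SignPattern n) (σ : Equiv.Perm (Fin n)) :
    (P.permutationMatrix σ).det = Equiv.Perm.sign σ * ∏ v, (P v (σ v) : ℝ) := by
  have : P.permutationMatrix σ = Matrix.diagonal (fun v => (P v (σ v) : ℝ)) *
      (1 : Matrix (Fin n) (Fin n) ℝ).submatrix σ id := by
    ext v u
    rw [Matrix.diagonal_mul, Matrix.submatrix_apply, id, Matrix.one_apply, permutationMatrix,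
      Matrix.of_apply]
    by_cases h : u = σ v
    · simp [h]
    · simp [h, Ne.symm h]
  rw [this, Matrix.det_mul, Matrix.det_permute, Matrix.det_diagonal, Matrix.det_one, mul_one,
    mul_comm]

lemma prod_map_eq_neg_one_pow {α : Type*} (l : List α) (f : α → SignType)
    (hf : ∀ x ∈ l, f x ≠ 0) :
    (l.map fun x => (f x : ℝ)).prod = (-1) ^ l.countP (fun x => f x = -1) := by
  induction l with
  | nil => simp
  | cons x l ih =>
    rw [List.map_cons, List.prod_cons, ih fun y hy => hf y (List.mem_cons_of_mem x hy),
      List.countP_cons]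
    have hx := hf x List.mem_cons_self
    cases h : f x
    · exact absurd h hx
    · simp [pow_succ]
    · simp

end SignPattern

end CycleRoots

/-! ### The three cases -/

section MainCases

variable {n : ℕ}

namespace SignPattern

lemma graph_adj_iff {P : SignPattern n} (hsym : P.CombinatoriallySymmetric)
    (hdiag : P.ZeroDiagonal) {i j : Fin n} : P.graph.Adj i j ↔ P i j ≠ 0 := by
  constructor
  · rintro ⟨-, h⟩ h0
    exact h (by rw [h0, zero_mul])
  · intro h
    exact ⟨fun hij => h (hij ▸ hdiag i), mul_ne_zero h ((hsym i j).1 h)⟩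

lemma exists_adj_of_irreducible {P : SignPattern n} (hirr : P.Irreducible)
    (hsym : P.CombinatoriallySymmetric) (hdiag : P.ZeroDiagonal) {a b : Fin n} (hab : a ≠ b)
    (v : Fin n) : ∃ w, P.graph.Adj v w := by
  obtain ⟨i, hi, j, -, hij⟩ := hirr {v} (Finset.singleton_nonempty v) (fun h => hab (by
    have h1 := Finset.mem_univ a
    have h2 := Finset.mem_univ b
    rw [← h, Finset.mem_singleton] at h1 h2
    rw [h1, h2]))
  rw [Finset.mem_singleton] at hi
  subst hi
  exact ⟨j, (graph_adj_iff hsym hdiag).2 hij⟩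

lemma exists_adj_ne_of_degree_ne_one {V : Type*} [Fintype V] {G : SimpleGraph V}
    [DecidableRel G.Adj] (h : ∀ v, G.degree v ≠ 1) (v a : V) (ha : G.Adj v a) :
    ∃ b, b ≠ a ∧ G.Adj v b := by
  by_contra! hno
  apply h v
  rw [SimpleGraph.degree_eq_one_iff_existsUnique_adj]
  exact ⟨a, ha, fun b hb => by_contra fun hba => hno b hba hb⟩

lemma eq_one_or_eq_neg_one_of_ne_zero {s : SignType} (h : s ≠ 0) : s = 1 ∨ s = -1 := by
  revert h
  cases s <;> decide

/-- The permutations `ρ * h` and `ρ⁻¹ * h` have the same sign. Their entries agree off the cycle,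
and on it they multiply to the product of the edge signs, which is `-1`; so the two determinants
have opposite signs. -/
lemma not_requiresUniqueInertia_of_odd {P : SignPattern n}
    (hsym : P.CombinatoriallySymmetric) (hdiag : P.ZeroDiagonal) {a : Fin n}
    {c : P.graph.Walk a a} (hc : c.IsCycle)
    (hodd : Odd (c.edges.countP (fun e => P.edgeSign e = -1)))
    {h : Equiv.Perm (Fin n)} (hh : ∀ v ∈ c.support, h v = v)
    (hh' : ∀ v ∉ c.support, P.graph.Adj v (h v)) : ¬ P.RequiresUniqueInertia := by
  classical
  intro hP
  obtain ⟨ρ, hρ, hρ'⟩ := exists_rotation hc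
  obtain ⟨r1, r2, -, -⟩ := IsCycle.rotation_properties hc hρ
  have r1' : ∀ v, ρ.symm v ∈ c.support ↔ v ∈ c.support := fun v => by
    rw [← r1 (ρ.symm v), Equiv.apply_symm_apply]
  have hout : ∀ v ∉ c.support, h v ∉ c.support := fun v hv hc' => by
    have := h.injective (hh _ hc')
    exact hv (this ▸ hc')
  have hρs : ∀ v ∉ c.support, ρ.symm v = v := fun v hv => by
    rw [Equiv.symm_apply_eq, hρ' v hv]
  have hprod : (∏ v, (P v ((ρ * h) v) : ℝ)) * ∏ v, (P v ((ρ⁻¹ * h) v) : ℝ) = -1 := by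
    rw [← Finset.prod_mul_distrib]
    have h1 : ∀ v ∈ Finset.univ, v ∉ c.support.toFinset →
        (P v ((ρ * h) v) : ℝ) * (P v ((ρ⁻¹ * h) v) : ℝ) = 1 := by
      intro v _ hv
      rw [List.mem_toFinset] at hv
      rw [Equiv.Perm.mul_apply, Equiv.Perm.mul_apply, hρ' _ (hout v hv)]
      change (P v (h v) : ℝ) * (P v (ρ.symm (h v)) : ℝ) = 1
      rw [hρs _ (hout v hv)]
      rcases eq_one_or_eq_neg_one_of_ne_zero ((graph_adj_iff hsym hdiag).1 (hh' v hv)) with h0 | h0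
        <;> rw [h0] <;> simp
    rw [← Finset.prod_subset (Finset.subset_univ c.support.toFinset) h1]
    -- Reindexing by `ρ` puts the two entries of each edge at the same index.
    have h2 : ∏ v ∈ c.support.toFinset, (P v ((ρ⁻¹ * h) v) : ℝ) =
        ∏ v ∈ c.support.toFinset, (P (ρ v) v : ℝ) := by
      symm
      apply Finset.prod_bij (fun v _ => ρ v)
      · intro v hv
        rw [List.mem_toFinset] at hv ⊢
        exact (r1 v).2 hv
      · intro u _ v _ huv
        exact ρ.injective huv
      · intro v hv
        rw [List.mem_toFinset] at hv
        exact ⟨ρ.symm v, by rw [List.mem_toFinset]; exact (r1' v).2 hv, by simp⟩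
      · intro v hv
        rw [List.mem_toFinset] at hv
        rw [Equiv.Perm.mul_apply, hh _ ((r1 v).2 hv)]
        change (P (ρ v) v : ℝ) = (P (ρ v) (ρ.symm (ρ v)) : ℝ)
        rw [Equiv.symm_apply_apply]
    have h3 : ∏ v ∈ c.support.toFinset, (P v ((ρ * h) v) : ℝ) =
        ∏ v ∈ c.support.toFinset, (P v (ρ v) : ℝ) := by
      apply Finset.prod_congr rfl
      intro v hv
      rw [List.mem_toFinset] at hv
      rw [Equiv.Perm.mul_apply, hh v hv]
    rw [Finset.prod_mul_distrib, h2, h3, ← Finset.prod_mul_distrib]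
    have h4 : ∀ v ∈ c.support.toFinset, (P v (ρ v) : ℝ) * (P (ρ v) v : ℝ) =
        (P.edgeSign s(v, ρ v) : ℝ) := fun v _ => by
      rw [← SignType.coe_mul]
      rfl
    rw [Finset.prod_congr rfl h4, prod_support_eq hc hρ (fun e => (P.edgeSign e : ℝ)),
      prod_map_eq_neg_one_pow _ _ ?_, hodd.neg_one_pow]
    intro e he
    induction e with | _ x y =>
    exact (c.adj_of_mem_edges he).2
  have hdet : (P.permutationMatrix (ρ * h)).det * (P.permutationMatrix (ρ⁻¹ * h)).det = -1 := by
    rw [det_permutationMatrix, det_permutationMatrix, Equiv.Perm.sign_mul, Equiv.Perm.sign_mul,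
      Equiv.Perm.sign_inv, mul_mul_mul_comm, hprod]
    rcases Int.units_eq_one_or (Equiv.Perm.sign ρ * Equiv.Perm.sign h) with h0 | h0 <;> rw [h0] <;>
      simp
  rcases mul_neg_iff.1 (show (P.permutationMatrix (ρ * h)).det *
    (P.permutationMatrix (ρ⁻¹ * h)).det < 0 by rw [hdet]; norm_num) with ⟨h1, h2⟩ | ⟨h1, h2⟩
  · exact hP.not_det_neg_pos (permutationMatrix_inClosure P _) (permutationMatrix_inClosure P _)
      h2 h1
  · exact hP.not_det_neg_pos (permutationMatrix_inClosure P _) (permutationMatrix_inClosure P _)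
      h1 h2

lemma card_neg_add_card_pos {P : SignPattern n} {m : Fin n → Fin n}
    (h : ∀ v, P.pairSign m v ≠ 0) :
    (Finset.univ.filter fun v => P.pairSign m v = -1).card +
      (Finset.univ.filter fun v => P.pairSign m v = 1).card = n := by
  have h1 := Finset.card_filter_add_card_filter_not (s := (Finset.univ : Finset (Fin n)))
    (fun v => P.pairSign m v = -1)
  rw [Finset.card_univ, Fintype.card_fin] at h1
  conv_rhs => rw [← h1]
  congr 2
  ext v
  rw [Finset.mem_filter, Finset.mem_filter]
  rcases eq_one_or_eq_neg_one_of_ne_zero (h v) with h0 | h0 <;> rw [h0] <;> simp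

/-- The perfect matching `m₁` forces `i₀ ≥ n - q`, with `q` the number of vertices on its positive
edges. These all lie off the cycle, so rotating the cycle and keeping `m₀` elsewhere forces `i₀ ≤ n
- q - 1`. -/
lemma not_requiresUniqueInertia_of_all_neg {P : SignPattern n} (hdiag : P.ZeroDiagonal)
    {col : Fin n → Bool} (hcol : ∀ i j, P i j ≠ 0 → col i ≠ col j) {a : Fin n}
    {c : P.graph.Walk a a} (hc : c.IsCycle) (hneg : ∀ e ∈ c.edges, P.edgeSign e = -1)
    {m₀ m₁ : Fin n → Fin n} (h₀ : ∀ v, m₀ (m₀ v) = v) (h₁ : ∀ v, m₁ (m₁ v) = v)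
    (hin₀ : ∀ v ∈ c.support, m₀ v = v) (hin₁ : ∀ v ∈ c.support, s(v, m₁ v) ∈ c.edges)
    (hout : ∀ v ∉ c.support, m₁ v = m₀ v ∧ P.graph.Adj v (m₀ v)) :
    ¬ P.RequiresUniqueInertia := by
  rintro ⟨t, ht⟩
  have hs : ∀ v ∈ c.support, P.pairSign m₁ v = -1 := fun v hv => hneg _ (hin₁ v hv)
  have hne : ∀ v, P.pairSign m₁ v ≠ 0 := by
    intro v
    by_cases hv : v ∈ c.support
    · rw [hs v hv]
      decide
    · rw [pairSign, (hout v hv).1]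
      exact (hout v hv).2.2
  have h1 := card_neg_add_card_pos hne
  have h2 := card_neg_le hdiag ht h₁ hcol
  have h3 := cycle_add_card_pos_le hdiag ht hc h₀ hin₀
  have h4 : (Finset.univ.filter fun v => P.pairSign m₁ v = 1).card ≤
      (Finset.univ.filter fun v => P.pairSign m₀ v = 1).card := by
    apply Finset.card_le_card
    intro v hv
    rw [Finset.mem_filter] at hv ⊢
    refine ⟨hv.1, ?_⟩
    by_cases hvc : v ∈ c.support
    · rw [hs v hvc] at hv
      exact absurd hv.2 (by decide)
    · rw [pairSign, ← (hout v hvc).1]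
      exact hv.2
  omega

/-- A matching that has an edge on each second edge of a path of odd length whose edges have sign
`s` has more edges of sign `s` than a perfect matching whose edges at the ends of the path do not
have sign `s`. -/
lemma exists_involution_card_lt {P : SignPattern n} {s : SignType}
    {E : Set (Sym2 (Fin n))} {x y : Fin n} {p : P.graph.Walk x y}
    (hp : P.IsMaximalSignedPath E p) (hps : ∀ e ∈ p.edges, P.edgeSign e = s)
    (hpE : ∀ e ∈ E, e ∉ p.edges → (x ∈ e ∨ y ∈ e) → P.edgeSign e ≠ s) (hodd : Odd p.length)
    {m₁ m₂ : Fin n → Fin n} (h₁ : ∀ v, m₁ (m₁ v) = v) (h₂ : ∀ v, m₂ (m₂ v) = v)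
    (hE : ∀ u v, s(u, v) ∈ E → m₁ u = v ∨ m₂ u = v)
    (hE₂ : ∀ v ∈ p.support, s(v, m₂ v) ∈ E) (hne : ∀ v ∈ p.support, m₁ v ≠ m₂ v)
    (hx : m₁ x = p.getVert 1) :
    ∃ m : Fin n → Fin n, (∀ v, m (m v) = v) ∧
      (Finset.univ.filter fun v => P.pairSign m₂ v = s).card <
        (Finset.univ.filter fun v => P.pairSign m v = s).card := by
  obtain ⟨hpath, hpos, hsub, -⟩ := hp
  have hinj : ∀ i ≤ p.length, ∀ j ≤ p.length, p.getVert i = p.getVert j → i = j :=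
    fun i hi j hj hij => hpath.getVert_injOn hi hj hij
  have hedge : ∀ i < p.length, s(p.getVert i, p.getVert (i + 1)) ∈ p.edges := by
    intro i hi
    rw [walk_edges_eq_map_range]
    exact List.mem_map.2 ⟨i, by simpa using hi, rfl⟩
  -- The edges of the path belong alternately to `m₁` and `m₂`: two consecutive ones in the same
  -- involution would make the path turn back. As the length is odd, `m₁` has both end edges.
  have hstep : ∀ j, j < p.length → (Even j → m₁ (p.getVert j) = p.getVert (j + 1)) ∧
      (Odd j → m₂ (p.getVert j) = p.getVert (j + 1)) := by
    intro j
    induction j with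
    | zero =>
      intro _
      refine ⟨fun _ => ?_, fun h => absurd h (by decide)⟩
      rw [Walk.getVert_zero, hx]
    | succ j ih =>
      intro hj
      obtain ⟨ih1, ih2⟩ := ih (by omega)
      have hjE := hE _ _ (hsub _ (hedge (j + 1) hj))
      have hjne : p.getVert j ≠ p.getVert (j + 1 + 1) := fun h => by
        have := hinj j (by omega) (j + 1 + 1) (by omega) h
        omega
      constructor
      · intro he
        have ho : Odd j := by
          rw [Nat.even_add_one, Nat.not_even_iff_odd] at he
          exact he
        refine hjE.resolve_right fun h => hjne ?_
        rw [← h, ← ih2 ho, h₂]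
      · intro ho
        have he : Even j := by
          rw [Nat.odd_add_one, Nat.not_odd_iff_even] at ho
          exact ho
        refine hjE.resolve_left fun h => hjne ?_
        rw [← h, ← ih1 he, h₁]
  have hsupp₁ : ∀ v ∈ p.support, m₁ v ∈ p.support ∧ s(v, m₁ v) ∈ p.edges := by
    intro v hv
    obtain ⟨i, rfl, hi⟩ := Walk.mem_support_iff_exists_getVert.1 hv
    rcases Nat.even_or_odd i with he | ho
    · have hi' : i < p.length := lt_of_le_of_ne hi fun h => by
        rw [h] at he
        exact Nat.not_even_iff_odd.2 hodd he
      rw [(hstep i hi').1 he]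
      exact ⟨p.getVert_mem_support _, hedge i hi'⟩
    · obtain ⟨j, rfl⟩ : ∃ j, i = j + 1 := ⟨i - 1, by have := ho.pos; omega⟩
      have he : Even j := by
        rw [Nat.odd_add_one, Nat.not_odd_iff_even] at ho
        exact ho
      rw [← (hstep j (by omega)).1 he, h₁, (hstep j (by omega)).1 he, Sym2.eq_swap]
      exact ⟨p.getVert_mem_support _, hedge j (by omega)⟩
  have hsupp₂ : ∀ v ∈ p.support, v ≠ x → v ≠ y → m₂ v ∈ p.support := by
    intro v hv hvx hvy
    obtain ⟨i, rfl, hi⟩ := Walk.mem_support_iff_exists_getVert.1 hv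
    rcases Nat.even_or_odd i with he | ho
    · have hi0 : i ≠ 0 := fun h => hvx (by rw [h, Walk.getVert_zero])
      obtain ⟨j, rfl⟩ : ∃ j, i = j + 1 := ⟨i - 1, by omega⟩
      have ho : Odd j := by
        rw [Nat.even_add_one, Nat.not_even_iff_odd] at he
        exact he
      rw [← (hstep j (by omega)).2 ho, h₂]
      exact p.getVert_mem_support _
    · have hi' : i < p.length := lt_of_le_of_ne hi fun h => hvy (by rw [h, Walk.getVert_length])
      rw [(hstep i hi').2 ho]
      exact p.getVert_mem_support _
  -- Use `m₁` on the path and `m₂` elsewhere. Outside vertices whose `m₂`-partner is an end of the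
  -- path become unmatched; by maximality those edges did not have sign `s`.
  let m : Fin n → Fin n := fun v =>
    if v ∈ p.support then m₁ v else if m₂ v ∈ p.support then v else m₂ v
  have hm1 : ∀ v ∈ p.support, m v = m₁ v := fun v hv => if_pos hv
  have hm2 : ∀ v ∉ p.support, m₂ v ∉ p.support → m v = m₂ v := fun v hv hv' => by
    simp only [m, if_neg hv, if_neg hv']
  have hm3 : ∀ v ∉ p.support, m₂ v ∈ p.support → m v = v := fun v hv hv' => by
    simp only [m, if_neg hv, if_pos hv']
  refine ⟨m, fun v => ?_, ?_⟩
  · by_cases hv : v ∈ p.support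
    · rw [hm1 v hv, hm1 _ (hsupp₁ v hv).1, h₁]
    · by_cases hv' : m₂ v ∈ p.support
      · rw [hm3 v hv hv', hm3 v hv hv']
      · rw [hm2 v hv hv', hm2 _ hv' (by rwa [h₂]), h₂]
  · have hsign : ∀ v ∈ p.support, P.pairSign m v = s := by
      intro v hv
      rw [pairSign, hm1 v hv]
      exact hps _ (hsupp₁ v hv).2
    apply Finset.card_lt_card
    rw [Finset.ssubset_iff_of_subset]
    -- The end `x` is gained: its `m₂`-edge leaves the path and so does not have sign `s`.
    · refine ⟨x, by simpa using hsign x p.start_mem_support, ?_⟩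
      rw [Finset.mem_filter, not_and]
      intro _
      apply hpE _ (hE₂ x p.start_mem_support)
      · intro hmem
        have := hpath.eq_snd_of_mem_edges hmem
        exact hne x p.start_mem_support (by rw [hx, this])
      · left
        exact Sym2.mem_mk_left _ _
    · intro v hv
      rw [Finset.mem_filter] at hv ⊢
      refine ⟨hv.1, ?_⟩
      by_cases hvp : v ∈ p.support
      · exact hsign v hvp
      · by_cases hvp' : m₂ v ∈ p.support
        · exfalso
          have hend : m₂ v = x ∨ m₂ v = y := by
            by_contra! hcon
            have := hsupp₂ _ hvp' hcon.1 hcon.2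
            rw [h₂] at this
            exact hvp this
          have hmem := hE₂ _ hvp'
          rw [h₂] at hmem
          refine hpE _ hmem (fun h => hvp (p.snd_mem_support_of_mem_edges h)) ?_ ?_
          · rcases hend with h | h
            · exact Or.inl (by rw [h]; exact Sym2.mem_mk_left _ _)
            · exact Or.inr (by rw [h]; exact Sym2.mem_mk_left _ _)
          · rw [Sym2.eq_swap]
            exact hv.2
        · rw [pairSign, hm2 v hvp hvp']
          exact hv.2

/-- For the perfect matching `m₂` the lower and upper bounds on `i₀` coincide, so no involution can
have more pairs of either sign. -/
lemma not_requiresUniqueInertia_of_odd_path {P : SignPattern n} (hdiag : P.ZeroDiagonal)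
    {col : Fin n → Bool} (hcol : ∀ i j, P i j ≠ 0 → col i ≠ col j)
    {E : Set (Sym2 (Fin n))} {x y : Fin n} {p : P.graph.Walk x y}
    (hp : P.IsMaximalSignedPath E p) (hodd : Odd p.length)
    {m₁ m₂ : Fin n → Fin n} (h₁ : ∀ v, m₁ (m₁ v) = v) (h₂ : ∀ v, m₂ (m₂ v) = v)
    (hadj : ∀ v, P.graph.Adj v (m₂ v))
    (hE : ∀ u v, s(u, v) ∈ E → m₁ u = v ∨ m₂ u = v)
    (hE₂ : ∀ v ∈ p.support, s(v, m₂ v) ∈ E) (hne : ∀ v ∈ p.support, m₁ v ≠ m₂ v)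
    (hx : m₁ x = p.getVert 1) : ¬ P.RequiresUniqueInertia := by
  rintro ⟨t, ht⟩
  obtain ⟨s, hps, hpE⟩ := hp.2.2.2
  have hs : s ≠ 0 := by
    have h0 : s(p.getVert 0, p.getVert (0 + 1)) ∈ p.edges := by
      rw [walk_edges_eq_map_range]
      exact List.mem_map.2 ⟨0, by simpa using hp.2.1, rfl⟩
    rw [← hps _ h0]
    exact (p.adj_of_mem_edges h0).2
  obtain ⟨m, hm, hlt⟩ := exists_involution_card_lt hp hps hpE hodd h₁ h₂ hE hE₂ hne hx
  have h3 := card_neg_add_card_pos (P := P) (m := m₂) fun v => (hadj v).2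
  have h4 := card_neg_le hdiag ht h₂ hcol
  have h5 := add_card_pos_le hdiag ht h₂ hcol
  have h6 := card_neg_le hdiag ht hm hcol
  have h7 := add_card_pos_le hdiag ht hm hcol
  rcases eq_one_or_eq_neg_one_of_ne_zero hs with rfl | rfl <;> omega

end SignPattern

end MainCases

theorem theorem3p11 (n : ℕ) (P : SignPattern n)
    (hirr : P.Irreducible) (hsym : P.CombinatoriallySymmetric) (hdiag : P.ZeroDiagonal)
    (hcycle : ∃ (a : Fin n) (c : P.graph.Walk a a), c.IsCycle)
    (hleaf : ∀ v : Fin n, P.graph.degree v ≠ 1)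
    (hdist : ∀ (a b : Fin n) (c : P.graph.Walk a a) (c' : P.graph.Walk b b),
      c.IsCycle → c'.IsCycle → c.edgeSet ≠ c'.edgeSet →
      CycleGeometry.PathAdjacent c c' → Odd (CycleGeometry.cycleDist c c'))
    (h : (∃ (a : Fin n) (c : P.graph.Walk a a), c.IsCycle ∧
            Odd (c.edges.countP (fun e => P.edgeSign e = -1))) ∨
         ((∀ (a : Fin n) (c : P.graph.Walk a a), c.IsCycle → Even c.length) ∧
            ∃ (a : Fin n) (c : P.graph.Walk a a), c.IsCycle ∧
              ∀ e ∈ c.edges, P.edgeSign e = -1) ∨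
         ((∀ (a : Fin n) (c : P.graph.Walk a a), c.IsCycle → Even c.length) ∧
            ∃ (a : Fin n) (c : P.graph.Walk a a), c.IsCycle ∧
              ∃ (x y : Fin n) (p : P.graph.Walk x y),
                P.IsMaximalSignedPath c.edgeSet p ∧ Odd p.length)) :
    ¬ P.RequiresUniqueInertia := by
  obtain ⟨a₀, c₀, hc₀⟩ := hcycle
  have hdeg0 : ∀ v, ∃ w, P.graph.Adj v w :=
    SignPattern.exists_adj_of_irreducible hirr hsym hdiag
      (c₀.adj_getVert_succ (i := 0) (by have := hc₀.three_le_length; omega)).ne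
  have hdeg := SignPattern.exists_adj_ne_of_degree_ne_one hleaf
  rcases h with ⟨a, c, hc, hodd⟩ | ⟨heven, a, c, hc, hneg⟩ | ⟨heven, a, c, hc, x, y, p, hp, hodd⟩
  · obtain ⟨g, hg, hg'⟩ := exists_perm_off_cycle hdist hdeg0 hdeg hc
    exact SignPattern.not_requiresUniqueInertia_of_odd hsym hdiag hc hodd hg hg'
  · obtain ⟨col, hcol⟩ := exists_bool_coloring heven
    obtain ⟨m₀, m₁, m₂, h₀, h₁, h₂, hin, hout, hcyc, hE⟩ :=
      exists_matchings_of_cycle hdist hdeg0 hdeg hcol hc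
    exact SignPattern.not_requiresUniqueInertia_of_all_neg hdiag
      (fun i j hij => hcol i j ((SignPattern.graph_adj_iff hsym hdiag).2 hij)) hc hneg h₀ h₁ hin
      (fun v hv => (hcyc v hv).1) (fun v hv => ⟨(hout v hv).1, (hout v hv).2.2⟩)
  · obtain ⟨col, hcol⟩ := exists_bool_coloring heven
    obtain ⟨m₀, m₁, m₂, h₀, h₁, h₂, hin, hout, hcyc, hE⟩ :=
      exists_matchings_of_cycle hdist hdeg0 hdeg hcol hc
    have hcol' : ∀ i j, P i j ≠ 0 → col i ≠ col j := fun i j hij =>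
      hcol i j ((SignPattern.graph_adj_iff hsym hdiag).2 hij)
    have hadj₁ : ∀ v, P.graph.Adj v (m₁ v) := fun v => by
      by_cases hv : v ∈ c.support
      · exact c.adj_of_mem_edges (hcyc v hv).1
      · rw [(hout v hv).1]
        exact (hout v hv).2.2
    have hadj₂ : ∀ v, P.graph.Adj v (m₂ v) := fun v => by
      by_cases hv : v ∈ c.support
      · exact c.adj_of_mem_edges (hcyc v hv).2.1
      · rw [(hout v hv).2.1]
        exact (hout v hv).2.2
    have hpc : ∀ v ∈ p.support, v ∈ c.support := by
      intro v hv
      obtain ⟨e, he, hve⟩ := (Walk.mem_support_iff_exists_mem_edges_of_not_nil fun h =>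
        hp.2.1.ne' (Walk.length_eq_zero_iff.2 h)).1 hv
      exact (isCycle_mem_support_iff_edgeSet hc).2 ⟨e, hp.2.2.1 e he, hve⟩
    have hx : s(x, p.getVert 1) ∈ c.edges := by
      apply hp.2.2.1
      rw [walk_edges_eq_map_range]
      exact List.mem_map.2 ⟨0, by simpa using hp.2.1, by simp⟩
    -- The matching that contains the first edge of the path plays the role of `m₁`.
    rcases hE _ _ hx with h1 | h2
    · exact SignPattern.not_requiresUniqueInertia_of_odd_path hdiag hcol' hp hodd h₁ h₂ hadj₂ hE
        (fun v hv => (hcyc v (hpc v hv)).2.1) (fun v hv => (hcyc v (hpc v hv)).2.2) h1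
    · exact SignPattern.not_requiresUniqueInertia_of_odd_path hdiag hcol' hp hodd h₂ h₁ hadj₁
        (fun u v huv => (hE u v huv).symm) (fun v hv => (hcyc v (hpc v hv)).1)
        (fun v hv => (hcyc v (hpc v hv)).2.2.symm) h2
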